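/- Write $\log_2 T=\log\log T$. For real $x\ge 1$ and $y$, let $\Psi(x,y)$ be the number of positive integers $n\le x$ all of whose prime factors are at most $y$ (the $y$-friable integers up to $x$), and for real $t$ let $\Psi(x,y;t)=\sum n^{it}$, the sum being over the same integers $n$. The following holds unconditionally. (1) There is an absolute constant $C>0$ such that for all real $T,x,y$ with $2\le x\le T^{1/3}$ and $y\ge \log x\,\log T\,(\log_2 T)^5$, the inequality $$\Big|\sum_{n\le x}n^{it}-\Psi(x,y;t)\Big|\le C\,\frac{\Psi(x,y)}{(\log_2T)^2}$$ holds for all $t\in[1,T]$ outside a set of Lebesgue measure at most $T^{1-1/\log x}$. (2) There is an absolute constant $T_0$ such that for all real $T\ge T_0$ and $2\le x\le T^{1/3}$, the inequality $$\Big|\sum_{n\le x}n^{it}\Big|\le\Psi\big(x,(\log T+(\log x)^2)(\log_2T)^5\big)$$ holds for all $t\in[1,T]$ outside a set of Lebesgue measure at most $T^{1-1/(\log_2T)^2}$. -/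

import Mathlib

/-- `n` is a `y`-friable positive integer: every prime factor of `n` is at most `y`. -/
def IsFriable (y : ℝ) (n : ℕ) : Prop :=
  n ≠ 0 ∧ ∀ p : ℕ, p.Prime → p ∣ n → (p : ℝ) ≤ y

open Classical in
/-- The `y`-friable integers `1 ≤ n ≤ x`. -/
noncomputable def friableUpTo (x y : ℝ) : Finset ℕ :=
  (Finset.Icc 1 ⌊x⌋₊).filter (IsFriable y)

/-- `Ψ(x, y)`, the number of `y`-friable integers up to `x`. -/
noncomputable def friableCount (x y : ℝ) : ℝ :=
  ((friableUpTo x y).card : ℝ)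

/-- `Ψ(x, y; t)`, the sum of `n ^ (i t)` over the `y`-friable integers `n ≤ x`. -/
noncomputable def friableSum (x y t : ℝ) : ℂ :=
  ∑ n ∈ friableUpTo x y, (n : ℂ) ^ (Complex.I * (t : ℂ))

/-- The zeta sum: the sum of `n ^ (i t)` over the integers `1 ≤ n ≤ x`. -/
noncomputable def zetaSum (x t : ℝ) : ℂ :=
  ∑ n ∈ Finset.Icc 1 ⌊x⌋₊, (n : ℂ) ^ (Complex.I * (t : ℂ))

/-!
Write `n ≤ x` as `b * m` with `m` friable and `b` free of primes `≤ y`. The `2k`-th moment over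
`t ∈ [1, T]` of a sum of `n ^ (i t)` with `x ^ k ≤ T` counts coincidences between products of `k`
terms, and forgetting the friable parts `m` can only create more of them. The moment is therefore
at most of order `T` times the `k`-th power of `∑ k ^ Ω(b) * Ψ(x / b, y) ^ 2` over rough `b`, where
`b = 1` is the friable part and is absent for the difference in part (1). By submultiplicativity of
the largest ratio `Ψ(x / z, y) / Ψ(x, y)`, this sum is at most an Euler product over the primes
`y < p ≤ x`, which a mean-square bound for the ratio shows to be at most
`exp (O(k * (log x) ^ 2 * log y / y)) * Ψ(x, y) ^ 2`. Chebyshev's inequality gives part (1).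

For part (2), the large values are compared with `Ψ(x, Y)`, where `Y` exceeds `y` by the factor
`(log log T) ^ 2`: removing the primes between `y` and `Y` one at a time, `Ψ(x, Y) / Ψ(x, y)` is
exponentially large because `Ψ(x / p, p) / Ψ(x, p)` is at least of order `log x / (p * log p)`.
-/

open Filter Finset MeasureTheory Real
open scoped ArithmeticFunction.Omega ArithmeticFunction.vonMangoldt Chebyshev

/-! ### Chebyshev bounds -/

/-- The primes `p` with `a < p ≤ b`, for nonnegative reals `a`, `b`. -/
noncomputable def primesIoc (a b : ℝ) : Finset ℕ :=
  {p ∈ Ioc ⌊a⌋₊ ⌊b⌋₊ | p.Prime}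

theorem mem_primesIoc {a b : ℝ} (ha : 0 ≤ a) (hb : 0 ≤ b) {p : ℕ} :
    p ∈ primesIoc a b ↔ p.Prime ∧ a < p ∧ (p : ℝ) ≤ b := by
  simp only [primesIoc, mem_filter, mem_Ioc, Nat.floor_lt ha, Nat.le_floor_iff hb]
  tauto

theorem primesIoc_subset_primesIoc {a b a' b' : ℝ} (ha : a' ≤ a) (hb : b ≤ b') :
    primesIoc a b ⊆ primesIoc a' b' :=
  filter_subset_filter _ (Ioc_subset_Ioc (Nat.floor_le_floor ha) (Nat.floor_le_floor hb))

theorem primesIoc_union_primesIoc {a b c : ℝ} (hab : a ≤ b) (hbc : b ≤ c) :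
    primesIoc a b ∪ primesIoc b c = primesIoc a c := by
  rw [primesIoc, primesIoc, primesIoc, ← filter_union,
    Ioc_union_Ioc_eq_Ioc (Nat.floor_le_floor hab) (Nat.floor_le_floor hbc)]

theorem disjoint_primesIoc (a b c : ℝ) : Disjoint (primesIoc a b) (primesIoc b c) :=
  disjoint_filter_filter (Ioc_disjoint_Ioc_of_le le_rfl)

theorem theta_sub_theta {a b : ℝ} (hab : a ≤ b) :
    θ b - θ a = ∑ p ∈ primesIoc a b, log p := by
  rw [sub_eq_iff_eq_add']
  rw [Chebyshev.theta, Chebyshev.theta, primesIoc, ← sum_union, ← filter_union,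
    Ioc_union_Ioc_eq_Ioc (Nat.zero_le _) (Nat.floor_le_floor hab)]
  exact disjoint_filter_filter (Ioc_disjoint_Ioc_of_le le_rfl)

theorem log_four : log 4 = 2 * log 2 := by
  rw [show (4 : ℝ) = 2 ^ 2 by norm_num, log_pow, Nat.cast_two]

theorem eventually_half_mul_le_theta : ∀ᶠ z : ℝ in atTop, z / 2 ≤ θ z := by
  have hlog : ∀ᶠ z : ℝ in atTop, log (z + 2) ≤ 0.01 * (z + 2) := by
    filter_upwards [(tendsto_atTop_add_const_right _ 2 tendsto_id).eventually
      (isLittleO_log_id_atTop.bound (c := 0.01) (by norm_num)), eventually_ge_atTop 0] with z hz hz0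
    simpa [abs_of_nonneg (by linarith : 0 ≤ z + 2)] using (le_abs_self _).trans hz
  have hsqrt : ∀ᶠ z : ℝ in atTop, log z ≤ 0.01 * √z := by
    filter_upwards [(isLittleO_log_rpow_atTop (r := 1 / 2) (by norm_num)).bound
      (c := 0.01) (by norm_num), eventually_ge_atTop 0] with z hz hz0
    simpa [sqrt_eq_rpow, abs_of_nonneg (rpow_nonneg hz0 _)] using (le_abs_self _).trans hz
  filter_upwards [hlog, hsqrt, eventually_ge_atTop 100] with z h₁ h₂ hz
  have h₃ : 2 * √z * log z ≤ 0.02 * z :=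
    calc 2 * √z * log z ≤ 2 * √z * (0.01 * √z) := by gcongr
      _ = 0.02 * (√z * √z) := by ring
      _ = 0.02 * z := by rw [mul_self_sqrt (by linarith)]
  have h₄ : (z - 1) * 0.69 ≤ (z - 1) * log 2 := by
    gcongr
    · linarith
    · linarith [log_two_gt_d9]
  linarith [Chebyshev.theta_ge' (x := z) (by linarith)]

theorem exists_mul_le_theta : ∃ c : ℝ, 0 < c ∧ c ≤ 1 ∧ ∀ z : ℝ, 2 ≤ z → c * z ≤ θ z := by
  obtain ⟨N, hN⟩ := eventually_atTop.1 eventually_half_mul_le_theta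
  set M := max N 2
  have hM : 2 ≤ M := le_max_right _ _
  have hθ2 := Chebyshev.theta_pos le_rfl
  refine ⟨min (1 / 2) (θ 2 / M), by positivity, (min_le_left _ _).trans (by norm_num),
    fun z hz ↦ ?_⟩
  rcases le_total M z with h | h
  · calc min (1 / 2) (θ 2 / M) * z ≤ 1 / 2 * z := by gcongr; exact min_le_left _ _
      _ = z / 2 := by ring
      _ ≤ θ z := hN z ((le_max_left _ _).trans h)
  · calc min (1 / 2) (θ 2 / M) * z ≤ θ 2 / M * M := by gcongr; exact min_le_right _ _
      _ = θ 2 := by field_simp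
      _ ≤ θ z := Chebyshev.theta_mono hz

theorem exists_mul_le_theta_sub_theta : ∃ s : ℕ, 0 < s ∧ ∃ c : ℝ, 0 < c ∧
    ∀ w : ℝ, 2 ≤ w → c * w ≤ θ w - θ (w / 2 ^ s) := by
  obtain ⟨c, hc, -, hθ⟩ := exists_mul_le_theta
  obtain ⟨s, hs⟩ := pow_unbounded_of_one_lt (2 * log 4 / c) one_lt_two
  have hs' : log 4 / 2 ^ s ≤ c / 2 := by
    rw [div_lt_iff₀ hc] at hs
    rw [div_le_iff₀ (by positivity)]
    linarith
  refine ⟨s + 1, by omega, c / 2, by positivity, fun w hw ↦ ?_⟩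
  have hsmall : θ (w / 2 ^ (s + 1)) ≤ c / 2 * w :=
    calc θ (w / 2 ^ (s + 1)) ≤ log 4 * (w / 2 ^ (s + 1)) :=
          Chebyshev.theta_le_log4_mul_x (by positivity)
      _ = log 4 / 2 ^ s * w / 2 := by rw [pow_succ]; ring
      _ ≤ c / 2 * w / 2 := by gcongr
      _ ≤ c / 2 * w := half_le_self (by positivity)
  linarith [hθ w hw]

theorem exists_mul_div_log_le_card_primesIoc : ∃ s : ℕ, 0 < s ∧ ∃ c : ℝ, 0 < c ∧
    ∀ w : ℝ, 2 ≤ w → c * w / log w ≤ #(primesIoc (w / 2 ^ s) w) := by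
  obtain ⟨s, hs, c, hc, h⟩ := exists_mul_le_theta_sub_theta
  refine ⟨s, hs, c, hc, fun w hw ↦ ?_⟩
  rw [div_le_iff₀ (log_pos (by linarith))]
  calc c * w ≤ θ w - θ (w / 2 ^ s) := h w hw
    _ = ∑ p ∈ primesIoc (w / 2 ^ s) w, log p :=
        theta_sub_theta (div_le_self (by linarith) (one_le_pow₀ (by norm_num)))
    _ ≤ #(primesIoc (w / 2 ^ s) w) • log w := by
        refine sum_le_card_nsmul _ _ _ fun p hp ↦ ?_
        rw [mem_primesIoc (by positivity) (by linarith)] at hp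
        exact log_le_log (mod_cast hp.1.pos) hp.2.2
    _ = #(primesIoc (w / 2 ^ s) w) * log w := nsmul_eq_mul _ _

theorem card_primesIoc_two_mul_le {V : ℝ} (hV : 1 < V) :
    (#(primesIoc V (2 * V)) : ℝ) ≤ 2 * log 4 * V / log V := by
  rw [le_div_iff₀ (log_pos hV)]
  calc (#(primesIoc V (2 * V)) : ℝ) * log V
      = #(primesIoc V (2 * V)) • log V := (nsmul_eq_mul _ _).symm
    _ ≤ ∑ p ∈ primesIoc V (2 * V), log p := by
        refine card_nsmul_le_sum _ _ _ fun p hp ↦ ?_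
        rw [mem_primesIoc (by linarith) (by linarith)] at hp
        exact log_le_log (by linarith) hp.2.1.le
    _ = θ (2 * V) - θ V := (theta_sub_theta (by linarith)).symm
    _ ≤ log 4 * (2 * V) := by
        linarith [Chebyshev.theta_le_log4_mul_x (x := 2 * V) (by linarith),
          Chebyshev.theta_nonneg V]
    _ = 2 * log 4 * V := by ring

theorem exists_div_log_le_sum_inv_primesIoc_mul : ∃ K : ℝ, 1 < K ∧ ∃ c : ℝ, 0 < c ∧
    ∀ z : ℝ, 1 ≤ z → c / log (K * z) ≤ ∑ p ∈ primesIoc z (K * z), (1 : ℝ) / p := by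
  obtain ⟨s, hs, c, hc, h⟩ := exists_mul_div_log_le_card_primesIoc
  have hK : (2 : ℝ) ≤ 2 ^ s := le_self_pow₀ one_le_two hs.ne'
  refine ⟨2 ^ s, by linarith, c, hc, fun z hz ↦ ?_⟩
  set w := 2 ^ s * z
  have hw : 2 ≤ w := by nlinarith
  have hcard : c * w / log w ≤ #(primesIoc z w) := by
    simpa only [w, mul_div_cancel_left₀ z (pow_ne_zero s two_ne_zero)] using h w hw
  calc c / log w = c * w / log w * (1 / w) := by field_simp
    _ ≤ #(primesIoc z w) * (1 / w) := by gcongr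
    _ = #(primesIoc z w) • (1 / w) := (nsmul_eq_mul _ _).symm
    _ ≤ ∑ p ∈ primesIoc z w, (1 : ℝ) / p := by
        refine card_nsmul_le_sum _ _ _ fun p hp ↦ ?_
        rw [mem_primesIoc (by linarith) (by linarith)] at hp
        exact one_div_le_one_div_of_le (mod_cast hp.1.pos) hp.2.2

theorem nsmul_le_sum_inv_primesIoc {K Y δ : ℝ} (hK : 1 ≤ K)
    (hδ : ∀ z, 1 ≤ z → K * z ≤ Y → δ ≤ ∑ p ∈ primesIoc z (K * z), (1 : ℝ) / p) (n : ℕ) :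
    ∀ z, 1 ≤ z → K ^ n * z ≤ Y → n * δ ≤ ∑ p ∈ primesIoc z Y, (1 : ℝ) / p := by
  induction n with
  | zero =>
    intro z _ _
    rw [Nat.cast_zero, zero_mul]
    positivity
  | succ n ih =>
    intro z hz hY
    have hzK : z ≤ K * z := le_mul_of_one_le_left (by linarith) hK
    have hKY : K * z ≤ Y :=
      (mul_le_mul_of_nonneg_right (le_self_pow₀ hK n.succ_ne_zero) (by linarith)).trans hY
    rw [← primesIoc_union_primesIoc hzK hKY, sum_union (disjoint_primesIoc _ _ _)]
    have htail := ih (K * z) (hz.trans hzK) (by rwa [← mul_assoc, ← pow_succ])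
    push_cast
    linarith [hδ z hz hKY]

theorem exists_mul_log_div_log_le_sum_inv_primesIoc : ∃ K : ℝ, 1 < K ∧ ∃ c : ℝ, 0 < c ∧
    ∀ z Y : ℝ, 1 ≤ z → K * z ≤ Y →
      c * log (Y / z) / log Y ≤ ∑ p ∈ primesIoc z Y, (1 : ℝ) / p := by
  obtain ⟨K, hK, c, hc, hblock⟩ := exists_div_log_le_sum_inv_primesIoc_mul
  have hlK : 0 < log K := log_pos hK
  refine ⟨K, hK, c / (2 * log K), by positivity, fun z Y hz hY ↦ ?_⟩
  have hz0 : 0 < z := by linarith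
  have hKY : K ≤ Y / z := (le_div_iff₀ hz0).2 hY
  have hlY : 0 ≤ log Y := log_nonneg (by nlinarith)
  set r := log (Y / z) / log K with hr
  have hr1 : 1 ≤ r := (one_le_div hlK).2 (log_le_log (by linarith) hKY)
  have hfloor : r / 2 ≤ ⌊r⌋₊ := by
    have h1 : (1 : ℝ) ≤ ⌊r⌋₊ := mod_cast Nat.le_floor (by simpa using hr1)
    linarith [Nat.lt_floor_add_one r]
  have hpow : K ^ ⌊r⌋₊ * z ≤ Y := by
    rw [← le_div_iff₀ hz0, ← log_le_log_iff (by positivity) (by linarith), log_pow,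
      ← le_div_iff₀ hlK]
    exact Nat.floor_le (by linarith)
  calc c / (2 * log K) * log (Y / z) / log Y = r / 2 * (c / log Y) := by rw [hr]; field_simp
    _ ≤ ⌊r⌋₊ * (c / log Y) := by gcongr
    _ ≤ ∑ p ∈ primesIoc z Y, (1 : ℝ) / p := by
        refine nsmul_le_sum_inv_primesIoc hK.le (fun z' hz' hY' ↦ ?_) _ z hz hpow
        refine le_trans ?_ (hblock z' hz')
        have : 0 < log (K * z') := log_pos (by nlinarith)
        gcongr

/-! ### Friable integers -/

theorem isFriable_one (y : ℝ) : IsFriable y 1 :=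
  ⟨one_ne_zero, fun _ hp h ↦ absurd (Nat.dvd_one.1 h) hp.ne_one⟩

theorem isFriable_of_le {y : ℝ} {n : ℕ} (hn : n ≠ 0) (h : (n : ℝ) ≤ y) : IsFriable y n :=
  ⟨hn, fun _ _ hpn ↦ le_trans (mod_cast Nat.le_of_dvd (Nat.pos_of_ne_zero hn) hpn) h⟩

namespace IsFriable

variable {y y' : ℝ} {m n : ℕ}

theorem one_le (hn : IsFriable y n) : (1 : ℝ) ≤ n :=
  mod_cast Nat.one_le_iff_ne_zero.2 hn.1

theorem pos (hn : IsFriable y n) : (0 : ℝ) < n :=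
  one_pos.trans_le hn.one_le

theorem of_dvd (hn : IsFriable y n) (h : m ∣ n) : IsFriable y m :=
  ⟨ne_zero_of_dvd_ne_zero hn.1 h, fun p hp hpm ↦ hn.2 p hp (hpm.trans h)⟩

theorem mul (hm : IsFriable y m) (hn : IsFriable y n) : IsFriable y (m * n) :=
  ⟨mul_ne_zero hm.1 hn.1, fun p hp h ↦ (hp.dvd_mul.1 h).elim (hm.2 p hp) (hn.2 p hp)⟩

theorem mono (h : y ≤ y') (hn : IsFriable y n) : IsFriable y' n :=
  ⟨hn.1, fun p hp hpn ↦ (hn.2 p hp hpn).trans h⟩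

theorem prod {ι : Type*} {s : Finset ι} {f : ι → ℕ} (h : ∀ i ∈ s, IsFriable y (f i)) :
    IsFriable y (∏ i ∈ s, f i) :=
  prod_induction f _ (fun _ _ ↦ mul) (isFriable_one y) h

end IsFriable

theorem mem_friableUpTo {x y : ℝ} {n : ℕ} :
    n ∈ friableUpTo x y ↔ (n : ℝ) ≤ x ∧ IsFriable y n := by
  simp only [friableUpTo, mem_filter, mem_Icc, Nat.one_le_iff_ne_zero]
  exact ⟨fun ⟨⟨h₀, hx⟩, hn⟩ ↦ ⟨(Nat.le_floor_iff' h₀).1 hx, hn⟩,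
    fun ⟨hx, hn⟩ ↦ ⟨⟨hn.1, (Nat.le_floor_iff' hn.1).2 hx⟩, hn⟩⟩

theorem mem_friableUpTo_div {x y : ℝ} {d m : ℕ} (hd : IsFriable y d) :
    m ∈ friableUpTo (x / d) y ↔ (d * m : ℝ) ≤ x ∧ IsFriable y m := by
  rw [mem_friableUpTo, le_div_iff₀' hd.pos]

theorem friableUpTo_mono {x x' y y' : ℝ} (hx : x ≤ x') (hy : y ≤ y') :
    friableUpTo x y ⊆ friableUpTo x' y' := fun n hn ↦ by
  rw [mem_friableUpTo] at hn ⊢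
  exact ⟨hn.1.trans hx, hn.2.mono hy⟩

theorem friableUpTo_eq_Icc {x y : ℝ} (hxy : x ≤ y) : friableUpTo x y = Icc 1 ⌊x⌋₊ := by
  classical
  refine filter_true_of_mem fun n hn ↦ ?_
  rw [mem_Icc, Nat.one_le_iff_ne_zero] at hn
  exact isFriable_of_le hn.1 (((Nat.le_floor_iff' hn.1).1 hn.2).trans hxy)

theorem friableCount_mono {x x' y y' : ℝ} (hx : x ≤ x') (hy : y ≤ y') :
    friableCount x y ≤ friableCount x' y' :=
  Nat.cast_le.2 (card_le_card (friableUpTo_mono hx hy))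

theorem friableCount_div_mono {x y z z' : ℝ} (hx : 0 ≤ x) (hz : 0 < z) (h : z ≤ z') :
    friableCount (x / z') y ≤ friableCount (x / z) y :=
  friableCount_mono (div_le_div_of_nonneg_left hx hz h) le_rfl

theorem friableCount_div_le_self {x y z : ℝ} (hx : 0 ≤ x) (hz : 1 ≤ z) :
    friableCount (x / z) y ≤ friableCount x y :=
  friableCount_mono (div_le_self hx hz) le_rfl

theorem friableCount_nonneg (x y : ℝ) : 0 ≤ friableCount x y :=
  Nat.cast_nonneg _

theorem one_le_friableCount {x : ℝ} (hx : 1 ≤ x) (y : ℝ) : 1 ≤ friableCount x y :=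
  Nat.one_le_cast.2 <| card_pos.2 ⟨1, mem_friableUpTo.2 ⟨by simpa using hx, isFriable_one y⟩⟩

theorem friableCount_pos {x : ℝ} (hx : 1 ≤ x) (y : ℝ) : 0 < friableCount x y :=
  one_pos.trans_le (one_le_friableCount hx y)

theorem friableCount_eq_zero {x : ℝ} (hx : x < 1) (y : ℝ) : friableCount x y = 0 := by
  rw [friableCount, Nat.cast_eq_zero, card_eq_zero]
  refine eq_empty_of_forall_notMem fun n hn ↦ ?_
  rw [mem_friableUpTo] at hn
  linarith [hn.1, hn.2.one_le]

theorem friableCount_eq_floor {x y : ℝ} (hxy : x ≤ y) : friableCount x y = ⌊x⌋₊ := by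
  simp [friableCount, friableUpTo_eq_Icc hxy]

theorem friableCount_le_self {x : ℝ} (hx : 0 ≤ x) (y : ℝ) : friableCount x y ≤ x :=
  calc friableCount x y ≤ friableCount x (max x y) := friableCount_mono le_rfl (le_max_right _ _)
    _ = ⌊x⌋₊ := friableCount_eq_floor (le_max_left _ _)
    _ ≤ x := Nat.floor_le hx

theorem card_filter_dvd_friableUpTo {x y : ℝ} {d : ℕ} (hd : IsFriable y d) :
    (#{n ∈ friableUpTo x y | d ∣ n} : ℝ) = friableCount (x / d) y := by
  rw [friableCount, Nat.cast_inj]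
  symm
  refine card_bij (fun m _ ↦ d * m) (fun m hm ↦ ?_)
    (fun a _ b _ h ↦ Nat.eq_of_mul_eq_mul_left (Nat.pos_of_ne_zero hd.1) h) fun n hn ↦ ?_
  · rw [mem_friableUpTo_div hd] at hm
    rw [mem_filter, mem_friableUpTo, Nat.cast_mul]
    exact ⟨⟨hm.1, hd.mul hm.2⟩, dvd_mul_right _ _⟩
  · rw [mem_filter, mem_friableUpTo] at hn
    obtain ⟨⟨hx, hy⟩, m, rfl⟩ := hn
    rw [Nat.cast_mul] at hx
    exact ⟨m, (mem_friableUpTo_div hd).2 ⟨hx, hy.of_dvd (dvd_mul_left _ _)⟩, rfl⟩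

theorem sum_friableUpTo_sum_dvd {x y : ℝ} (D : Finset ℕ) (hD : ∀ d ∈ D, IsFriable y d)
    (w : ℕ → ℝ) :
    ∑ n ∈ friableUpTo x y, ∑ d ∈ D with d ∣ n, w d = ∑ d ∈ D, w d * friableCount (x / d) y := by
  simp_rw [sum_filter]
  rw [sum_comm]
  refine sum_congr rfl fun d hd ↦ ?_
  rw [← sum_filter, sum_const, nsmul_eq_mul, card_filter_dvd_friableUpTo (hD d hd), mul_comm]

/-- The Chebyshev function `ψ` restricted to powers of primes `p ≤ y`: the sum of `Λ(d)` over the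
`y`-friable `d ≤ V`. -/
noncomputable def friablePsi (V y : ℝ) : ℝ :=
  ∑ d ∈ friableUpTo V y, Λ d

theorem friablePsi_nonneg (V y : ℝ) : 0 ≤ friablePsi V y :=
  sum_nonneg fun _ _ ↦ ArithmeticFunction.vonMangoldt_nonneg

theorem log_eq_sum_vonMangoldt_friableUpTo {x y : ℝ} {n : ℕ} (hn : n ∈ friableUpTo x y) :
    log n = ∑ d ∈ friableUpTo x y with d ∣ n, Λ d := by
  rw [mem_friableUpTo] at hn
  rw [← ArithmeticFunction.vonMangoldt_sum]
  congr 1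
  ext d
  rw [mem_filter, Nat.mem_divisors, mem_friableUpTo]
  refine ⟨fun ⟨hd, _⟩ ↦ ⟨⟨le_trans ?_ hn.1, hn.2.of_dvd hd⟩, hd⟩, fun ⟨_, hd⟩ ↦ ⟨hd, hn.2.1⟩⟩
  exact mod_cast Nat.le_of_dvd (Nat.pos_of_ne_zero hn.2.1) hd

theorem mem_friableUpTo_and_mem_div_comm {x y : ℝ} {d m : ℕ} :
    d ∈ friableUpTo x y ∧ m ∈ friableUpTo (x / d) y ↔
      d ∈ friableUpTo (x / m) y ∧ m ∈ friableUpTo x y := by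
  suffices h : ∀ {a b : ℕ}, a ∈ friableUpTo x y ∧ b ∈ friableUpTo (x / a) y →
      a ∈ friableUpTo (x / b) y ∧ b ∈ friableUpTo x y from
    ⟨h, fun H ↦ (h H.symm).symm⟩
  rintro a b ⟨ha, hb⟩
  rw [mem_friableUpTo] at ha
  rw [mem_friableUpTo_div ha.2] at hb
  rw [mem_friableUpTo_div hb.2, mem_friableUpTo, mul_comm]
  exact ⟨⟨hb.1, ha.2⟩, (le_mul_of_one_le_left hb.2.pos.le ha.2.one_le).trans hb.1, hb.2⟩

theorem sum_log_friableUpTo (x y : ℝ) :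
    ∑ n ∈ friableUpTo x y, log n = ∑ m ∈ friableUpTo x y, friablePsi (x / m) y := by
  rw [sum_congr rfl fun n ↦ log_eq_sum_vonMangoldt_friableUpTo,
    sum_friableUpTo_sum_dvd _ fun d hd ↦ (mem_friableUpTo.1 hd).2]
  simp_rw [friablePsi, friableCount, card_eq_sum_ones, Nat.cast_sum, mul_sum, Nat.cast_one, mul_one]
  exact sum_comm' fun _ _ ↦ mem_friableUpTo_and_mem_div_comm

theorem sum_log_friableUpTo_le (x y : ℝ) :
    ∑ n ∈ friableUpTo x y, log n ≤ friableCount x y * log x := by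
  rw [friableCount, ← nsmul_eq_mul]
  refine sum_le_card_nsmul _ _ _ fun n hn ↦ ?_
  rw [mem_friableUpTo] at hn
  exact log_le_log hn.2.pos hn.1

theorem sum_log_prime_dvd_le_log {n : ℕ} (hn : n ≠ 0) {P : Finset ℕ}
    (hP : ∀ p ∈ P, p.Prime ∧ p ∣ n) : ∑ p ∈ P, log p ≤ log n :=
  calc ∑ p ∈ P, log p = ∑ p ∈ P, Λ p :=
        sum_congr rfl fun p hp ↦ (ArithmeticFunction.vonMangoldt_apply_prime (hP p hp).1).symm
    _ ≤ ∑ d ∈ n.divisors, Λ d :=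
        sum_le_sum_of_subset_of_nonneg (fun p hp ↦ Nat.mem_divisors.2 ⟨(hP p hp).2, hn⟩)
          fun _ _ _ ↦ ArithmeticFunction.vonMangoldt_nonneg
    _ = log n := ArithmeticFunction.vonMangoldt_sum

theorem friableCount_div_mul_theta_le {x y z : ℝ} (hz : 0 < z) (hzy : z ≤ y) (hx : 0 ≤ x) :
    friableCount (x / z) y * θ z ≤ friableCount x y * log x := by
  have hP : ∀ p ∈ primesIoc 0 z, p.Prime ∧ (p : ℝ) ≤ z := fun p hp ↦
    let ⟨hp, _, hpz⟩ := (mem_primesIoc le_rfl hz.le).1 hp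
    ⟨hp, hpz⟩
  calc friableCount (x / z) y * θ z
      = ∑ p ∈ primesIoc 0 z, log p * friableCount (x / z) y := by
        rw [← sum_mul, ← theta_sub_theta hz.le, Chebyshev.theta_zero, sub_zero, mul_comm]
    _ ≤ ∑ p ∈ primesIoc 0 z, log p * friableCount (x / p) y := by
        refine sum_le_sum fun p hp ↦ mul_le_mul_of_nonneg_left ?_ (log_natCast_nonneg p)
        exact friableCount_div_mono hx (mod_cast (hP p hp).1.pos) (hP p hp).2
    _ = ∑ n ∈ friableUpTo x y, ∑ p ∈ primesIoc 0 z with p ∣ n, log p :=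
        (sum_friableUpTo_sum_dvd _ (fun p hp ↦
          isFriable_of_le (hP p hp).1.ne_zero ((hP p hp).2.trans hzy)) _).symm
    _ ≤ ∑ n ∈ friableUpTo x y, log n := by
        gcongr with n hn
        refine sum_log_prime_dvd_le_log (mem_friableUpTo.1 hn).2.1 fun p hp ↦ ?_
        rw [mem_filter] at hp
        exact ⟨(hP p hp.1).1, hp.2⟩
    _ ≤ friableCount x y * log x := sum_log_friableUpTo_le x y

/-! ### The decay of `Ψ(x / z, y) / Ψ(x, y)` in `z` -/

/-- The largest ratio `Ψ(x / z, y) / Ψ(x, y)` over `1 ≤ x ≤ X`. Taking the supremum makes it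
submultiplicative in `z`; it stands in for the `z ^ (-α)` of the saddle-point estimates. -/
noncomputable def friableRatio (X y z : ℝ) : ℝ :=
  sSup ((fun x ↦ friableCount (x / z) y / friableCount x y) '' Set.Icc 1 X)

section friableRatio

variable {X y z z' : ℝ}

theorem friableRatio_le {c : ℝ} (hX : 1 ≤ X)
    (h : ∀ x, 1 ≤ x → x ≤ X → friableCount (x / z) y ≤ c * friableCount x y) :
    friableRatio X y z ≤ c := by
  refine csSup_le ((Set.nonempty_Icc.2 hX).image _) ?_
  rintro _ ⟨x, ⟨h1, h2⟩, rfl⟩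
  exact (div_le_iff₀ (friableCount_pos h1 y)).2 (h x h1 h2)

theorem friableCount_div_le {x : ℝ} (hz : 1 ≤ z) (hx : x ≤ X) :
    friableCount (x / z) y ≤ friableRatio X y z * friableCount x y := by
  rcases lt_or_ge x 1 with h1 | h1
  · have : x / z < 1 := by rw [div_lt_iff₀ (by linarith)]; linarith
    rw [friableCount_eq_zero h1, friableCount_eq_zero this, mul_zero]
  · rw [← div_le_iff₀ (friableCount_pos h1 y)]
    refine le_csSup ⟨1, ?_⟩ ⟨x, ⟨h1, hx⟩, rfl⟩
    rintro _ ⟨x, ⟨h1, -⟩, rfl⟩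
    exact div_le_one_of_le₀ (friableCount_div_le_self (by linarith) hz) (friableCount_nonneg _ _)

theorem friableRatio_nonneg (X y z : ℝ) : 0 ≤ friableRatio X y z := by
  refine Real.sSup_nonneg ?_
  rintro _ ⟨x, -, rfl⟩
  exact div_nonneg (friableCount_nonneg _ _) (friableCount_nonneg _ _)

theorem friableRatio_le_one (hX : 1 ≤ X) (hz : 1 ≤ z) : friableRatio X y z ≤ 1 :=
  friableRatio_le hX fun x h1 _ ↦ by
    rw [one_mul]
    exact friableCount_div_le_self (by linarith) hz

theorem friableRatio_anti (hX : 1 ≤ X) (hz : 1 ≤ z) (h : z ≤ z') :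
    friableRatio X y z' ≤ friableRatio X y z :=
  friableRatio_le hX fun _ h1 h2 ↦
    (friableCount_div_mono (by linarith) (by linarith) h).trans (friableCount_div_le hz h2)

theorem friableRatio_mul_le (hX : 1 ≤ X) (hz : 1 ≤ z) (hz' : 1 ≤ z') :
    friableRatio X y (z * z') ≤ friableRatio X y z * friableRatio X y z' :=
  friableRatio_le hX fun x h1 h2 ↦
    calc friableCount (x / (z * z')) y = friableCount (x / z / z') y := by rw [div_div]
      _ ≤ friableRatio X y z' * friableCount (x / z) y :=
        friableCount_div_le hz' ((div_le_self (by linarith) hz).trans h2)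
      _ ≤ friableRatio X y z' * (friableRatio X y z * friableCount x y) :=
        mul_le_mul_of_nonneg_left (friableCount_div_le hz h2) (friableRatio_nonneg _ _ _)
      _ = friableRatio X y z * friableRatio X y z' * friableCount x y := by ring

theorem friableRatio_pow_le (hX : 1 ≤ X) (hz : 1 ≤ z) (n : ℕ) :
    friableRatio X y (z ^ n) ≤ friableRatio X y z ^ n := by
  induction n with
  | zero => simpa using friableRatio_le_one hX le_rfl
  | succ n ih =>
    rw [pow_succ, pow_succ]
    exact (friableRatio_mul_le hX (one_le_pow₀ hz) hz).trans
      (mul_le_mul_of_nonneg_right ih (friableRatio_nonneg _ _ _))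

end friableRatio

theorem exists_friableRatio_le_mul_log_div : ∃ C : ℝ, 1 ≤ C ∧ ∀ X y z : ℝ, 1 ≤ X → 2 ≤ z → z ≤ y →
    friableRatio X y z ≤ C * log X / z := by
  obtain ⟨c, hc, hc1, hθ⟩ := exists_mul_le_theta
  refine ⟨1 / c, (one_le_div hc).2 hc1, fun X y z hX hz hzy ↦ friableRatio_le hX fun x h1 h2 ↦ ?_⟩
  have hcz : 0 < c * z := by positivity
  have hmain : friableCount (x / z) y * (c * z) ≤ friableCount x y * log X :=
    calc friableCount (x / z) y * (c * z) ≤ friableCount (x / z) y * θ z :=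
          mul_le_mul_of_nonneg_left (hθ z hz) (friableCount_nonneg _ _)
      _ ≤ friableCount x y * log x :=
          friableCount_div_mul_theta_le (by linarith) hzy (by linarith)
      _ ≤ friableCount x y * log X :=
          mul_le_mul_of_nonneg_left (log_le_log (by linarith) h2) (friableCount_nonneg _ _)
  calc friableCount (x / z) y ≤ friableCount x y * log X / (c * z) := (le_div_iff₀ hcz).2 hmain
    _ = 1 / c * log X / z * friableCount x y := by field_simp

/-! ### Mean square of the friable ratio -/

theorem choose_card_filter_dvd {P : Finset ℕ} (hP : ∀ p ∈ P, p.Prime) (m n : ℕ) :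
    (#{p ∈ P | p ∣ n}).choose m = #{R ∈ P.powersetCard m | ∏ p ∈ R, p ∣ n} := by
  rw [← card_powersetCard]
  congr 1
  ext R
  simp only [mem_powersetCard, mem_filter]
  constructor
  · rintro ⟨hR, hm⟩
    have hRP : R ⊆ P := hR.trans (filter_subset _ _)
    exact ⟨⟨hRP, hm⟩, prod_primes_dvd n (fun p hp ↦ (hP p (hRP hp)).prime)
      fun p hp ↦ (mem_filter.1 (hR hp)).2⟩
  · rintro ⟨⟨hR, hm⟩, hdvd⟩
    exact ⟨fun p hp ↦ mem_filter.2 ⟨hR hp, (dvd_prod_of_mem _ hp).trans hdvd⟩, hm⟩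

theorem sum_choose_card_filter_dvd_le {x y a : ℝ} (hx : 0 ≤ x) (ha : 0 < a) {P : Finset ℕ}
    (hP : ∀ p ∈ P, p.Prime ∧ a ≤ p ∧ (p : ℝ) ≤ y) (m : ℕ) :
    ∑ n ∈ friableUpTo x y, ((#{p ∈ P | p ∣ n}).choose m : ℝ) ≤
      (#P).choose m * friableCount (x / a ^ m) y := by
  simp_rw [choose_card_filter_dvd fun p hp ↦ (hP p hp).1, card_filter, Nat.cast_sum, Nat.cast_ite,
    Nat.cast_one, Nat.cast_zero]
  rw [sum_comm, ← card_powersetCard, ← nsmul_eq_mul]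
  refine sum_le_card_nsmul _ _ _ fun R hR ↦ ?_
  rw [mem_powersetCard] at hR
  have hfri : IsFriable y (∏ p ∈ R, p) := IsFriable.prod fun p hp ↦
    isFriable_of_le (hP p (hR.1 hp)).1.ne_zero (hP p (hR.1 hp)).2.2
  have hprod : a ^ m ≤ (∏ p ∈ R, p : ℕ) := by
    rw [← hR.2, ← prod_const, Nat.cast_prod]
    exact prod_le_prod (fun _ _ ↦ ha.le) fun p hp ↦ (hP p (hR.1 hp)).2.1
  rw [sum_boole, card_filter_dvd_friableUpTo hfri]
  exact friableCount_div_mono hx (by positivity) hprod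

theorem sum_descFactorial_card_filter_dvd_le {x y a : ℝ} (hx : 0 ≤ x) (ha : 0 < a) {P : Finset ℕ}
    (hP : ∀ p ∈ P, p.Prime ∧ a ≤ p ∧ (p : ℝ) ≤ y) (m : ℕ) :
    ∑ n ∈ friableUpTo x y, ((#{p ∈ P | p ∣ n}).descFactorial m : ℝ) ≤
      #P ^ m * friableCount (x / a ^ m) y := by
  simp_rw [Nat.descFactorial_eq_factorial_mul_choose, Nat.cast_mul]
  rw [← mul_sum]
  calc (m.factorial : ℝ) * ∑ n ∈ friableUpTo x y, ((#{p ∈ P | p ∣ n}).choose m : ℝ)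
      ≤ m.factorial * ((#P).choose m * friableCount (x / a ^ m) y) := by
        gcongr
        exact sum_choose_card_filter_dvd_le hx ha hP m
    _ = (#P).descFactorial m * friableCount (x / a ^ m) y := by
        rw [Nat.descFactorial_eq_factorial_mul_choose]; push_cast; ring
    _ ≤ #P ^ m * friableCount (x / a ^ m) y := by
        gcongr
        · exact friableCount_nonneg _ _
        · exact_mod_cast Nat.descFactorial_le_pow _ _

theorem friableCount_div_mul_card_le_sum {x y b : ℝ} (hx : 0 ≤ x) (hby : b ≤ y) {P : Finset ℕ}
    (hP : ∀ p ∈ P, p.Prime ∧ (p : ℝ) ≤ b) :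
    friableCount (x / b) y * #P ≤ ∑ n ∈ friableUpTo x y, (#{p ∈ P | p ∣ n} : ℝ) := by
  have hsum := sum_friableUpTo_sum_dvd (x := x) P
    (fun p hp ↦ isFriable_of_le (hP p hp).1.ne_zero ((hP p hp).2.trans hby)) fun _ ↦ 1
  simp only [sum_const, nsmul_eq_mul, mul_one, one_mul] at hsum
  rw [hsum, mul_comm, ← nsmul_eq_mul]
  exact card_nsmul_le_sum _ _ _ fun p hp ↦
    friableCount_div_mono hx (mod_cast (hP p hp).1.pos) (hP p hp).2

theorem natCast_le_add_descFactorial {ω m : ℕ} (hm : 1 ≤ m) {τ : ℝ} (hτ : 0 < τ) :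
    (ω : ℝ) ≤ 2 * m + τ + τ * (2 / τ) ^ m * ω.descFactorial m := by
  have hlast : 0 ≤ τ * (2 / τ) ^ m * ω.descFactorial m := by positivity
  rcases lt_or_ge ω (2 * m) with hωm | hωm
  · have : (ω : ℝ) ≤ 2 * m := mod_cast hωm.le
    linarith
  rcases le_or_gt (ω : ℝ) τ with hωτ | hωτ
  · linarith [Nat.cast_nonneg (α := ℝ) m]
  have hhalf : (ω : ℝ) / 2 ≤ (ω + 1 - m : ℕ) := by
    have : (ω : ℝ) ≤ 2 * (ω + 1 - m : ℕ) := mod_cast (by lia : ω ≤ 2 * (ω + 1 - m))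
    linarith
  have hdesc : ((ω : ℝ) / 2) ^ m ≤ ω.descFactorial m :=
    (pow_le_pow_left₀ (by positivity) hhalf m).trans (mod_cast Nat.pow_sub_le_descFactorial ω m)
  have hpow : (ω : ℝ) / τ ≤ (ω / τ) ^ m := le_self_pow₀ ((one_le_div hτ).2 hωτ.le) (by lia)
  calc (ω : ℝ) = τ * (ω / τ) := by field_simp
    _ ≤ τ * (ω / τ) ^ m := by gcongr
    _ = τ * (2 / τ) ^ m * (ω / 2) ^ m := by rw [mul_assoc, ← mul_pow]; congr 2; field_simp
    _ ≤ τ * (2 / τ) ^ m * ω.descFactorial m := by gcongr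
    _ ≤ _ := by linarith [Nat.cast_nonneg (α := ℝ) m]

/-- Taking the `m`-th factorial moment of the number of prime divisors of `n` in `P` transfers
a bound for the ratio at the scale `a ^ m` to the scale of the primes in `P`. -/
theorem friableRatio_mul_card_le {X y a b ρ : ℝ} (hX : 1 ≤ X) (ha : 1 ≤ a) (hρ : 0 < ρ)
    {P : Finset ℕ} (hP : ∀ p ∈ P, p.Prime ∧ a ≤ p ∧ (p : ℝ) ≤ b) (hne : P.Nonempty) (hby : b ≤ y)
    {m : ℕ} (hm : 1 ≤ m) (h : friableRatio X y (a ^ m) ≤ ρ ^ m) :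
    friableRatio X y b * #P ≤ 2 * m + 4 * #P * ρ := by
  have hcard : (0 : ℝ) < #P := mod_cast card_pos.2 hne
  rw [← le_div_iff₀ hcard]
  refine friableRatio_le hX fun x h1 h2 ↦ ?_
  have hx : 0 ≤ x := by linarith
  rw [div_mul_eq_mul_div, le_div_iff₀ hcard]
  set τ : ℝ := 2 * #P * ρ with hτ
  have hτ0 : 0 < τ := by positivity
  have hmoment : ∑ n ∈ friableUpTo x y, ((#{p ∈ P | p ∣ n}).descFactorial m : ℝ) ≤
      #P ^ m * (ρ ^ m * friableCount x y) :=
    calc ∑ n ∈ friableUpTo x y, ((#{p ∈ P | p ∣ n}).descFactorial m : ℝ)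
        ≤ #P ^ m * friableCount (x / a ^ m) y :=
          sum_descFactorial_card_filter_dvd_le hx (by linarith)
            (fun p hp ↦ ⟨(hP p hp).1, (hP p hp).2.1, (hP p hp).2.2.trans hby⟩) m
      _ ≤ #P ^ m * (ρ ^ m * friableCount x y) := by
          gcongr
          exact (friableCount_div_le (one_le_pow₀ ha) h2).trans
            (mul_le_mul_of_nonneg_right h (friableCount_nonneg x y))
  calc friableCount (x / b) y * #P
      ≤ ∑ n ∈ friableUpTo x y, (#{p ∈ P | p ∣ n} : ℝ) :=
        friableCount_div_mul_card_le_sum hx hby fun p hp ↦ ⟨(hP p hp).1, (hP p hp).2.2⟩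
    _ ≤ ∑ n ∈ friableUpTo x y,
          (2 * m + τ + τ * (2 / τ) ^ m * (#{p ∈ P | p ∣ n}).descFactorial m) :=
        sum_le_sum fun n _ ↦ natCast_le_add_descFactorial hm hτ0
    _ = friableCount x y * (2 * m + τ) + τ * (2 / τ) ^ m *
          ∑ n ∈ friableUpTo x y, ((#{p ∈ P | p ∣ n}).descFactorial m : ℝ) := by
        rw [sum_add_distrib, sum_const, nsmul_eq_mul, mul_sum, friableCount]
    _ ≤ friableCount x y * (2 * m + τ) + τ * (2 / τ) ^ m *
          (#P ^ m * (ρ ^ m * friableCount x y)) := by gcongr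
    _ = friableCount x y * (2 * m + τ) + τ * ((2 * #P * ρ / τ) ^ m * friableCount x y) := by
        rw [div_pow, div_pow, mul_pow, mul_pow]; ring
    _ = (2 * m + 4 * #P * ρ) * friableCount x y := by
        rw [← hτ, div_self hτ0.ne', one_pow, hτ]; ring

theorem friableRatio_two_pow_le_of_le_card {X y c r : ℝ} {s i I : ℕ} (hX : 1 ≤ X) (hc : 0 < c)
    (hr : 0 < r) (hi : 0 < i) (hiI : i ≤ I) (hIy : (2 : ℝ) ^ I ≤ y)
    (hcard : c * 2 ^ i / (i * log 2) ≤ #(primesIoc (2 ^ (i - s)) (2 ^ i)))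
    (h : friableRatio X y (2 ^ I) ≤ r ^ I) :
    friableRatio X y (2 ^ i) ≤ 2 * log 2 / c * (I * i / 2 ^ i) + 4 * r ^ (i - s) := by
  set P := primesIoc (2 ^ (i - s)) (2 ^ i)
  have hi0 : (0 : ℝ) < i := mod_cast hi
  have hlog : 0 < log 2 := log_pos one_lt_two
  have hP0 : (0 : ℝ) < #P := lt_of_lt_of_le (by positivity) hcard
  have hP : ∀ p ∈ P, p.Prime ∧ (2 : ℝ) ^ (i - s) ≤ p ∧ (p : ℝ) ≤ 2 ^ i := fun p hp ↦ by
    rw [mem_primesIoc (by positivity) (by positivity)] at hp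
    exact ⟨hp.1, hp.2.1.le, hp.2.2⟩
  have hpow : friableRatio X y ((2 ^ (i - s)) ^ I) ≤ (r ^ (i - s)) ^ I := by
    rw [pow_right_comm, pow_right_comm r]
    exact (friableRatio_pow_le hX (one_le_pow₀ one_le_two) _).trans
      (pow_le_pow_left₀ (friableRatio_nonneg _ _ _) h _)
  have hmain := friableRatio_mul_card_le hX (one_le_pow₀ one_le_two) (ρ := r ^ (i - s))
    (by positivity) hP (card_pos.1 (mod_cast hP0))
    ((pow_le_pow_right₀ one_le_two hiI).trans hIy) (hi.trans_le hiI) hpow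
  calc friableRatio X y (2 ^ i) ≤ (2 * I + 4 * #P * r ^ (i - s)) / #P := (le_div_iff₀ hP0).2 hmain
    _ = 2 * I / #P + 4 * r ^ (i - s) := by field_simp
    _ ≤ 2 * I / (c * 2 ^ i / (i * log 2)) + 4 * r ^ (i - s) := by gcongr
    _ = 2 * log 2 / c * (I * i / 2 ^ i) + 4 * r ^ (i - s) := by field_simp

theorem exists_friableRatio_two_pow_le : ∃ C : ℝ, 1 ≤ C ∧ ∀ (X y : ℝ) (I : ℕ), 1 ≤ X →
    (2 : ℝ) ^ I ≤ y → friableRatio X y (2 ^ I) ≤ (√2)⁻¹ ^ I → ∀ i ≤ I,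
      friableRatio X y (2 ^ i) ≤ C * (I * i / 2 ^ i + (√2)⁻¹ ^ i) := by
  obtain ⟨s, -, c, hc, hcard⟩ := exists_mul_div_log_le_card_primesIoc
  have hs : 1 ≤ (√2) ^ s := one_le_pow₀ (one_le_sqrt.2 one_le_two)
  refine ⟨max (2 * log 2 / c) (4 * (√2) ^ s), le_max_of_le_right (by linarith),
    fun X y I hX hIy h i hi ↦ ?_⟩
  set C := max (2 * log 2 / c) (4 * (√2) ^ s)
  have hC : 4 * (√2) ^ s ≤ C := le_max_right _ _
  have : 0 < C := lt_of_lt_of_le (by positivity) hC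
  rw [mul_add]
  rcases le_or_gt i s with his | hsi
  · have h1 : 1 ≤ C * (√2)⁻¹ ^ i := by
      rw [inv_pow, ← div_eq_mul_inv, one_le_div (by positivity)]
      have := pow_le_pow_right₀ (one_le_sqrt.2 one_le_two) his
      linarith
    have h2 : 0 ≤ C * (I * i / 2 ^ i) := by positivity
    linarith [friableRatio_le_one (y := y) hX (one_le_pow₀ (n := i) one_le_two)]
  · have hcard' : c * 2 ^ i / (i * log 2) ≤ #(primesIoc (2 ^ (i - s)) (2 ^ i)) := by
      have := hcard (2 ^ i) (le_self_pow₀ one_le_two (by lia))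
      rwa [log_pow, div_eq_mul_inv _ (2 ^ s), ← pow_sub₀ _ two_ne_zero hsi.le] at this
    refine (friableRatio_two_pow_le_of_le_card hX hc (by positivity) (by lia) hi hIy hcard'
      h).trans (add_le_add ?_ ?_)
    · gcongr
      exact le_max_left _ _
    · calc 4 * (√2)⁻¹ ^ (i - s) = 4 * (√2) ^ s * (√2)⁻¹ ^ i := by
            rw [inv_pow, inv_pow, pow_sub₀ _ (by positivity) hsi.le, mul_inv, inv_inv]; ring
        _ ≤ C * (√2)⁻¹ ^ i := by gcongr

theorem sum_sq_div_two_pow_le (N : ℕ) : ∑ i ∈ range N, (i : ℝ) ^ 2 / 2 ^ i ≤ 6 := by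
  have h : ∑ i ∈ range N, (i : ℝ) ^ 2 / 2 ^ i = 6 - 2 * ((N : ℝ) ^ 2 + 2 * N + 3) / 2 ^ N := by
    induction N with
    | zero => norm_num
    | succ n ih =>
      rw [sum_range_succ, ih, pow_succ]
      push_cast
      field_simp
      ring
  have : 0 ≤ 2 * ((N : ℝ) ^ 2 + 2 * N + 3) / 2 ^ N := by positivity
  linarith

theorem two_pow_mul_inv_sqrt_two_pow_sq (i : ℕ) : 2 ^ i * ((√2)⁻¹ ^ i) ^ 2 = (1 : ℝ) := by
  rw [pow_right_comm, inv_pow √2, sq_sqrt zero_le_two, ← mul_pow, mul_inv_cancel₀ two_ne_zero,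
    one_pow]

theorem sum_two_pow_mul_sq_le {f : ℕ → ℝ} {C : ℝ} {I : ℕ}
    (hf : ∀ i ≤ I, 0 ≤ f i ∧ f i ≤ C * (I * i / 2 ^ i + (√2)⁻¹ ^ i)) :
    ∑ i ∈ range I, 2 ^ i * f i ^ 2 ≤ 14 * C ^ 2 * I ^ 2 := by
  have hterm : ∀ i ∈ range I,
      2 ^ i * f i ^ 2 ≤ 2 * C ^ 2 * (I ^ 2 * ((i : ℝ) ^ 2 / 2 ^ i) + 1) := by
    intro i hi
    obtain ⟨h0, h1⟩ := hf i (mem_range.1 hi).le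
    calc 2 ^ i * f i ^ 2 ≤ 2 ^ i * (C * (I * i / 2 ^ i + (√2)⁻¹ ^ i)) ^ 2 := by gcongr
      _ ≤ 2 ^ i * (C ^ 2 * (2 * ((I * i / 2 ^ i) ^ 2 + ((√2)⁻¹ ^ i) ^ 2))) := by
          rw [mul_pow]
          gcongr
          exact add_sq_le
      _ = 2 * C ^ 2 * (2 ^ i * (I * i / 2 ^ i) ^ 2 + 2 ^ i * ((√2)⁻¹ ^ i) ^ 2) := by ring
      _ = 2 * C ^ 2 * (I ^ 2 * ((i : ℝ) ^ 2 / 2 ^ i) + 1) := by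
          rw [two_pow_mul_inv_sqrt_two_pow_sq]; congr 2; field_simp
  calc ∑ i ∈ range I, 2 ^ i * f i ^ 2
      ≤ ∑ i ∈ range I, 2 * C ^ 2 * (I ^ 2 * ((i : ℝ) ^ 2 / 2 ^ i) + 1) := sum_le_sum hterm
    _ = 2 * C ^ 2 * (I ^ 2 * ∑ i ∈ range I, (i : ℝ) ^ 2 / 2 ^ i + I) := by
        rw [← mul_sum, sum_add_distrib, ← mul_sum]; simp
    _ ≤ 2 * C ^ 2 * (I ^ 2 * 6 + I ^ 2) := by
        have := sum_sq_div_two_pow_le I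
        have : (I : ℝ) ≤ I ^ 2 := mod_cast Nat.le_self_pow two_ne_zero I
        gcongr
    _ = 14 * C ^ 2 * I ^ 2 := by ring

theorem friableRatio_two_pow_add_le {X : ℝ} (hX : 1 ≤ X) (y : ℝ) (i j : ℕ) :
    friableRatio X y (2 ^ (i + j)) ≤ friableRatio X y (2 ^ i) * friableRatio X y (2 ^ j) := by
  rw [pow_add]
  exact friableRatio_mul_le hX (one_le_pow₀ one_le_two) (one_le_pow₀ one_le_two)

theorem sum_two_pow_mul_friableRatio_sq_le {X y : ℝ} (hX : 1 ≤ X) {I : ℕ}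
    (h : 2 ^ I * friableRatio X y (2 ^ I) ^ 2 ≤ 1 / 2) (N : ℕ) :
    ∑ i ∈ range N, 2 ^ i * friableRatio X y (2 ^ i) ^ 2 ≤
      2 * ∑ i ∈ range I, 2 ^ i * friableRatio X y (2 ^ i) ^ 2 := by
  set f : ℕ → ℝ := fun i ↦ 2 ^ i * friableRatio X y (2 ^ i) ^ 2 with hf
  have hf0 : ∀ i, 0 ≤ f i := fun i ↦ by positivity
  have hmul : ∀ i, f (I + i) ≤ 1 / 2 * f i := fun i ↦
    calc f (I + i) ≤ 2 ^ (I + i) * (friableRatio X y (2 ^ I) * friableRatio X y (2 ^ i)) ^ 2 := by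
          have := friableRatio_nonneg X y (2 ^ (I + i))
          simp only [hf]
          gcongr
          exact friableRatio_two_pow_add_le hX y I i
      _ = 2 ^ I * friableRatio X y (2 ^ I) ^ 2 * f i := by simp only [hf]; ring
      _ ≤ 1 / 2 * f i := mul_le_mul_of_nonneg_right h (hf0 i)
  have hshift : ∑ i ∈ range N, f (I + i) ≤ 1 / 2 * ∑ i ∈ range N, f i := by
    rw [mul_sum]
    exact sum_le_sum fun i _ ↦ hmul i
  have hmono : ∑ i ∈ range N, f i ≤ ∑ i ∈ range (I + N), f i :=
    sum_le_sum_of_subset_of_nonneg (range_subset_range.2 (by lia)) fun i _ _ ↦ hf0 i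
  rw [sum_range_add] at hmono
  linarith

theorem sum_primesIoc_two_pow (f : ℕ → ℝ) (I N : ℕ) :
    ∑ p ∈ primesIoc (2 ^ I) (2 ^ (I + N)), f p =
      ∑ i ∈ range N, ∑ p ∈ primesIoc (2 ^ (I + i)) (2 * 2 ^ (I + i)), f p := by
  induction N with
  | zero => simp [primesIoc]
  | succ n ih =>
    rw [sum_range_succ, ← ih, ← sum_union (disjoint_primesIoc _ _ _), ← pow_succ',
      primesIoc_union_primesIoc (pow_le_pow_right₀ one_le_two (by lia))
        (pow_le_pow_right₀ one_le_two (by lia)), add_assoc]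

theorem sum_friableRatio_sq_primesIoc_two_pow_le {X : ℝ} (hX : 1 ≤ X) (y : ℝ) {I : ℕ} (hI : 1 ≤ I)
    (i : ℕ) :
    ∑ p ∈ primesIoc (2 ^ (I + i)) (2 * 2 ^ (I + i)), friableRatio X y p ^ 2 ≤
      4 / I * (2 ^ I * friableRatio X y (2 ^ I) ^ 2) * (2 ^ i * friableRatio X y (2 ^ i) ^ 2) := by
  have : (0 : ℝ) < I := mod_cast hI
  have : 0 < log 2 := log_pos one_lt_two
  have hbig : (1 : ℝ) < 2 ^ (I + i) := one_lt_pow₀ one_lt_two (by lia)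
  have hcard : (#(primesIoc (2 ^ (I + i)) (2 * 2 ^ (I + i))) : ℝ) ≤
      2 * log 4 * 2 ^ (I + i) / (I * log 2) := by
    refine (card_primesIoc_two_mul_le hbig).trans ?_
    rw [log_pow, log_four]
    gcongr
    simp
  calc ∑ p ∈ primesIoc (2 ^ (I + i)) (2 * 2 ^ (I + i)), friableRatio X y p ^ 2
      ≤ #(primesIoc (2 ^ (I + i)) (2 * 2 ^ (I + i))) *
          (friableRatio X y (2 ^ I) * friableRatio X y (2 ^ i)) ^ 2 := by
        rw [← nsmul_eq_mul]
        refine sum_le_card_nsmul _ _ _ fun p hp ↦ ?_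
        rw [mem_primesIoc (by positivity) (by positivity)] at hp
        have := friableRatio_nonneg X y p
        gcongr
        exact (friableRatio_anti hX hbig.le hp.2.1.le).trans (friableRatio_two_pow_add_le hX y I i)
    _ ≤ 2 * log 4 * 2 ^ (I + i) / (I * log 2) *
          (friableRatio X y (2 ^ I) * friableRatio X y (2 ^ i)) ^ 2 := by gcongr
    _ = 4 / I * (2 ^ I * friableRatio X y (2 ^ I) ^ 2) *
          (2 ^ i * friableRatio X y (2 ^ i) ^ 2) := by rw [log_four]; field_simp; ring

theorem sum_friableRatio_sq_primesIoc_le {X y : ℝ} (hX : 1 ≤ X) {I : ℕ} (hI : 1 ≤ I)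
    (hIy : (2 : ℝ) ^ I ≤ y) {B : ℝ}
    (hB : ∀ N, ∑ i ∈ range N, 2 ^ i * friableRatio X y (2 ^ i) ^ 2 ≤ B) :
    ∑ p ∈ primesIoc y X, friableRatio X y p ^ 2 ≤
      4 / I * (2 ^ I * friableRatio X y (2 ^ I) ^ 2) * B := by
  obtain ⟨N, hN⟩ := pow_unbounded_of_one_lt X one_lt_two
  calc ∑ p ∈ primesIoc y X, friableRatio X y p ^ 2
      ≤ ∑ p ∈ primesIoc (2 ^ I) (2 ^ (I + N)), friableRatio X y p ^ 2 :=
        sum_le_sum_of_subset_of_nonneg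
          (primesIoc_subset_primesIoc hIy
            (hN.le.trans (pow_le_pow_right₀ one_le_two (Nat.le_add_left _ _))))
          fun _ _ _ ↦ sq_nonneg _
    _ = ∑ i ∈ range N, ∑ p ∈ primesIoc (2 ^ (I + i)) (2 * 2 ^ (I + i)), friableRatio X y p ^ 2 :=
        sum_primesIoc_two_pow _ I N
    _ ≤ ∑ i ∈ range N, 4 / I * (2 ^ I * friableRatio X y (2 ^ I) ^ 2) *
          (2 ^ i * friableRatio X y (2 ^ i) ^ 2) :=
        sum_le_sum fun i _ ↦ sum_friableRatio_sq_primesIoc_two_pow_le hX y hI i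
    _ ≤ 4 / I * (2 ^ I * friableRatio X y (2 ^ I) ^ 2) * B := by
        rw [← mul_sum]
        exact mul_le_mul_of_nonneg_left (hB N) (by positivity)

theorem exists_two_pow_mul_friableRatio_sq_le : ∃ C : ℝ, 1 ≤ C ∧ ∀ (X y : ℝ) (I : ℕ), 1 ≤ X →
    1 ≤ I → 2 ^ I ≤ y → y < 2 ^ (I + 1) →
      2 ^ I * friableRatio X y (2 ^ I) ^ 2 ≤ 2 * C ^ 2 * log X ^ 2 / y := by
  obtain ⟨C, hC, hratio⟩ := exists_friableRatio_le_mul_log_div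
  refine ⟨C, hC, fun X y I hX hI hIy hyI ↦ ?_⟩
  have hy : 0 < y := (pow_pos two_pos I).trans_le hIy
  have hnonneg := friableRatio_nonneg X y (2 ^ I)
  calc 2 ^ I * friableRatio X y (2 ^ I) ^ 2 ≤ 2 ^ I * (C * log X / 2 ^ I) ^ 2 := by
        gcongr
        exact hratio X y (2 ^ I) hX (le_self_pow₀ one_le_two (by lia)) hIy
    _ = C ^ 2 * log X ^ 2 / 2 ^ I := by field_simp
    _ ≤ C ^ 2 * log X ^ 2 / (y / 2) := by
        rw [pow_succ] at hyI
        gcongr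
        linarith
    _ = 2 * C ^ 2 * log X ^ 2 / y := by field_simp

theorem exists_sum_friableRatio_sq_le : ∃ C : ℝ, 1 ≤ C ∧ ∀ X y : ℝ, 1 ≤ X → 2 ≤ y →
    C * log X ^ 2 ≤ y →
      ∑ p ∈ primesIoc y X, friableRatio X y p ^ 2 ≤ C * log X ^ 2 * log y / y := by
  obtain ⟨C₁, hC₁, h₁⟩ := exists_two_pow_mul_friableRatio_sq_le
  obtain ⟨C₂, hC₂, h₂⟩ := exists_friableRatio_two_pow_le
  have hC₁₂ : C₁ ^ 2 ≤ C₁ ^ 2 * C₂ ^ 2 := le_mul_of_one_le_right (sq_nonneg _) (one_le_pow₀ hC₂)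
  refine ⟨448 * C₁ ^ 2 * C₂ ^ 2, by linarith [one_le_pow₀ hC₁ (n := 2)], fun X y hX hy hXy ↦ ?_⟩
  obtain ⟨I, hIy, hyI⟩ := exists_nat_pow_near (show 1 ≤ y by linarith) one_lt_two
  have hI : 1 ≤ I := by
    by_contra! h
    rw [Nat.lt_one_iff.1 h, zero_add, pow_one] at hyI
    linarith
  have hy0 : 0 < y := by linarith
  have hsq : 2 ^ I * friableRatio X y (2 ^ I) ^ 2 ≤ 2 * C₁ ^ 2 * log X ^ 2 / y :=
    h₁ X y I hX hI hIy hyI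
  have hhalf : 2 ^ I * friableRatio X y (2 ^ I) ^ 2 ≤ 1 / 2 := by
    refine hsq.trans ?_
    rw [div_le_iff₀ hy0]
    linarith [mul_le_mul_of_nonneg_right hC₁₂ (sq_nonneg (log X)),
      mul_nonneg (sq_nonneg C₁) (sq_nonneg (log X))]
  have hroot : friableRatio X y (2 ^ I) ≤ (√2)⁻¹ ^ I := by
    refine le_of_sq_le_sq (le_of_mul_le_mul_left ?_ (pow_pos two_pos I)) (by positivity)
    linarith [two_pow_mul_inv_sqrt_two_pow_sq I]
  have hsum : ∑ i ∈ range I, 2 ^ i * friableRatio X y (2 ^ i) ^ 2 ≤ 14 * C₂ ^ 2 * I ^ 2 :=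
    sum_two_pow_mul_sq_le fun i hi ↦ ⟨friableRatio_nonneg _ _ _, h₂ X y I hX hIy hroot i hi⟩
  have hIlog : (I : ℝ) ≤ 2 * log y := by
    have : I * log 2 ≤ log y := by
      rw [← log_pow]; exact log_le_log (by positivity) hIy
    nlinarith [log_two_gt_d9]
  calc ∑ p ∈ primesIoc y X, friableRatio X y p ^ 2
      ≤ 4 / I * (2 ^ I * friableRatio X y (2 ^ I) ^ 2) * (2 * (14 * C₂ ^ 2 * I ^ 2)) :=
        sum_friableRatio_sq_primesIoc_le hX hI hIy fun N ↦
          (sum_two_pow_mul_friableRatio_sq_le hX hhalf N).trans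
            (mul_le_mul_of_nonneg_left hsum zero_le_two)
    _ ≤ 4 / I * (2 * C₁ ^ 2 * log X ^ 2 / y) * (2 * (14 * C₂ ^ 2 * I ^ 2)) := by gcongr
    _ = 224 * C₁ ^ 2 * C₂ ^ 2 * log X ^ 2 / y * I := by field_simp; ring
    _ ≤ 224 * C₁ ^ 2 * C₂ ^ 2 * log X ^ 2 / y * (2 * log y) := by gcongr
    _ = 448 * C₁ ^ 2 * C₂ ^ 2 * log X ^ 2 * log y / y := by ring

/-! ### Moments of Dirichlet polynomials -/

theorem card_finMulAntidiag_le_pow_cardFactors (k : ℕ) {n : ℕ} (hn : n ≠ 0) :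
    #(Nat.finMulAntidiag k n) ≤ k ^ Ω n := by
  induction n using induction_on_primes with
  | zero => exact absurd rfl hn
  | one => rw [Nat.finMulAntidiag_one]; simp
  | prime_mul p a hp ih =>
    have ha : a ≠ 0 := right_ne_zero_of_mul hn
    have hsub : Nat.finMulAntidiag k (p * a) ⊆ (univ ×ˢ Nat.finMulAntidiag k a).image
        fun q : Fin k × (Fin k → ℕ) ↦ Function.update q.2 q.1 (p * q.2 q.1) := by
      intro f hf
      rw [Nat.mem_finMulAntidiag] at hf
      obtain ⟨i, -, q, hq⟩ := (Prime.dvd_finsetProd_iff hp.prime f).1 (Dvd.intro _ hf.1.symm)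
      refine mem_image.2
        ⟨(i, Function.update f i q), mem_product.2 ⟨mem_univ _, ?_⟩, by simp [← hq]⟩
      have hprod := mul_prod_erase univ f (mem_univ i)
      rw [hq, hf.1, mul_assoc] at hprod
      rw [Nat.mem_finMulAntidiag, prod_update_of_mem (mem_univ i), sdiff_singleton_eq_erase]
      exact ⟨Nat.eq_of_mul_eq_mul_left hp.pos hprod, ha⟩
    calc #(Nat.finMulAntidiag k (p * a))
        ≤ #(univ ×ˢ Nat.finMulAntidiag k a : Finset (Fin k × (Fin k → ℕ))) :=
          (card_le_card hsub).trans card_image_le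
      _ = k * #(Nat.finMulAntidiag k a) := by simp [card_product]
      _ ≤ k * k ^ Ω a := Nat.mul_le_mul_left _ (ih ha)
      _ = k ^ Ω (p * a) := by
          rw [ArithmeticFunction.cardFactors_mul hp.ne_zero ha,
            ArithmeticFunction.cardFactors_apply_prime hp, pow_add, pow_one]

theorem cardFactors_prod {ι : Type*} (s : Finset ι) {f : ι → ℕ} (h : ∀ i ∈ s, f i ≠ 0) :
    Ω (∏ i ∈ s, f i) = ∑ i ∈ s, Ω (f i) := by
  classical
  induction s using Finset.induction_on with
  | empty => simp
  | insert a s ha ih =>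
    rw [forall_mem_insert] at h
    rw [prod_insert ha, sum_insert ha,
      ArithmeticFunction.cardFactors_mul h.1 (prod_ne_zero_iff.2 h.2), ih h.2]

/-- The number of `k`-tuples of elements of `A` whose product is `m`. -/
def tupleCount (A : Finset ℕ) (k m : ℕ) : ℕ :=
  #{ν ∈ Fintype.piFinset fun _ : Fin k ↦ A | ∏ i, ν i = m}

theorem sum_card_fiber_sq_le {α β γ : Type*} [DecidableEq β] [DecidableEq γ] (s : Finset α)
    (t : Finset β) (f : α → β) (g : β → γ) :
    ∑ b ∈ t, (#{a ∈ s | f a = b} : ℝ) ^ 2 ≤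
      ∑ c ∈ t.image g, (#{a ∈ s | g (f a) = c} : ℝ) ^ 2 := by
  rw [← sum_fiberwise_of_maps_to fun b hb ↦ mem_image_of_mem g hb]
  refine sum_le_sum fun c _ ↦
    (sum_sq_le_sq_sum_of_nonneg fun _ _ ↦ Nat.cast_nonneg _).trans ?_
  rw [← Nat.cast_sum, sum_card_fiberwise_eq_card_filter]
  gcongr with a
  exact fun h ↦ (mem_filter.1 h).2

theorem card_filter_prod_comp_eq {A : Finset ℕ} (ρ : ℕ → ℕ) (k l : ℕ) :
    #{ν ∈ Fintype.piFinset fun _ : Fin k ↦ A | ∏ i, ρ (ν i) = l} =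
      ∑ β ∈ Fintype.piFinset fun _ : Fin k ↦ A.image ρ with ∏ i, β i = l,
        ∏ i, #{n ∈ A | ρ n = β i} := by
  rw [card_eq_sum_card_fiberwise (f := fun ν i ↦ ρ (ν i)) fun ν hν ↦ ?_]
  · refine sum_congr rfl fun β hβ ↦ ?_
    rw [← Fintype.card_piFinset]
    congr 1
    ext ν
    simp only [mem_filter, Fintype.mem_piFinset, funext_iff, forall_and]
    refine and_congr_left fun hνβ ↦ and_iff_left ?_
    rw [← (mem_filter.1 hβ).2]
    exact prod_congr rfl fun i _ ↦ hνβ i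
  · simp only [coe_filter, Fintype.mem_piFinset, Set.mem_ofPred_eq] at hν ⊢
    exact ⟨fun i ↦ mem_image_of_mem ρ (hν.1 i), hν.2⟩

theorem sq_sum_filter_prod_le {R : Finset ℕ} (hR : 0 ∉ R) (W : ℕ → ℝ) (k l : ℕ) :
    (∑ β ∈ Fintype.piFinset fun _ : Fin k ↦ R with ∏ i, β i = l, ∏ i, W (β i)) ^ 2 ≤
      ∑ β ∈ Fintype.piFinset fun _ : Fin k ↦ R with ∏ i, β i = l,
        ∏ i, ((k : ℝ) ^ Ω (β i) * W (β i) ^ 2) := by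
  set S := {β ∈ Fintype.piFinset fun _ : Fin k ↦ R | ∏ i, β i = l} with hS
  have hmem : ∀ β ∈ S, (∀ i, β i ≠ 0) ∧ ∏ i, β i = l := fun β hβ ↦ by
    rw [hS, mem_filter, Fintype.mem_piFinset] at hβ
    exact ⟨fun i h ↦ hR (h ▸ hβ.1 i), hβ.2⟩
  have hcard : ∀ β ∈ S, (#S : ℝ) ≤ (k : ℝ) ^ Ω l := fun β hβ ↦ by
    have hl : l ≠ 0 := (hmem β hβ).2 ▸ prod_ne_zero_iff.2 fun i _ ↦ (hmem β hβ).1 i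
    have hsub : S ⊆ Nat.finMulAntidiag k l := fun γ hγ ↦
      Nat.mem_finMulAntidiag.2 ⟨(hmem γ hγ).2, hl⟩
    exact_mod_cast (card_le_card hsub).trans (card_finMulAntidiag_le_pow_cardFactors k hl)
  calc (∑ β ∈ S, ∏ i, W (β i)) ^ 2 ≤ #S * ∑ β ∈ S, (∏ i, W (β i)) ^ 2 := sq_sum_le_card_mul_sum_sq
    _ = ∑ β ∈ S, #S * (∏ i, W (β i)) ^ 2 := mul_sum _ _ _
    _ ≤ ∑ β ∈ S, (k : ℝ) ^ Ω l * (∏ i, W (β i)) ^ 2 :=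
        sum_le_sum fun β hβ ↦ mul_le_mul_of_nonneg_right (hcard β hβ) (sq_nonneg _)
    _ = ∑ β ∈ S, ∏ i, ((k : ℝ) ^ Ω (β i) * W (β i) ^ 2) := by
        refine sum_congr rfl fun β hβ ↦ ?_
        rw [prod_mul_distrib, prod_pow, prod_pow_eq_pow_sum,
          ← cardFactors_prod _ fun i _ ↦ (hmem β hβ).1 i, (hmem β hβ).2]

/-- Comparing products only through a multiplicative map `ρ` can only increase the mean square of
the number of representations. -/
theorem sum_tupleCount_sq_le {A : Finset ℕ} (ρ : ℕ →* ℕ) (hρ : ∀ n ∈ A, ρ n ≠ 0) (k : ℕ)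
    (M : Finset ℕ) :
    ∑ m ∈ M, (tupleCount A k m : ℝ) ^ 2 ≤
      (∑ b ∈ A.image ρ, (k : ℝ) ^ Ω b * (#{n ∈ A | ρ n = b} : ℝ) ^ 2) ^ k := by
  have h0 : 0 ∉ A.image ρ := fun h ↦ by
    obtain ⟨n, hn, hn0⟩ := mem_image.1 h
    exact hρ n hn hn0
  set W : ℕ → ℝ := fun b ↦ #{n ∈ A | ρ n = b} with hW
  have hfiber (l : ℕ) : (#{ν ∈ Fintype.piFinset fun _ : Fin k ↦ A | ρ (∏ i, ν i) = l} : ℝ) =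
      ∑ β ∈ Fintype.piFinset fun _ : Fin k ↦ A.image ρ with ∏ i, β i = l, ∏ i, W (β i) := by
    simp only [map_prod, hW]
    exact_mod_cast card_filter_prod_comp_eq ρ k l
  calc ∑ m ∈ M, (tupleCount A k m : ℝ) ^ 2
      ≤ ∑ l ∈ M.image ρ,
          (#{ν ∈ Fintype.piFinset fun _ : Fin k ↦ A | ρ (∏ i, ν i) = l} : ℝ) ^ 2 := by
        simp only [tupleCount]
        exact sum_card_fiber_sq_le _ M (fun ν : Fin k → ℕ ↦ ∏ i, ν i) ρ
    _ ≤ ∑ l ∈ M.image ρ, ∑ β ∈ Fintype.piFinset fun _ : Fin k ↦ A.image ρ with ∏ i, β i = l,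
          ∏ i, ((k : ℝ) ^ Ω (β i) * W (β i) ^ 2) := by
        refine sum_le_sum fun l _ ↦ ?_
        rw [hfiber]
        exact sq_sum_filter_prod_le h0 W k l
    _ ≤ ∑ β ∈ Fintype.piFinset fun _ : Fin k ↦ A.image ρ,
          ∏ i, ((k : ℝ) ^ Ω (β i) * W (β i) ^ 2) := by
        rw [sum_fiberwise_eq_sum_filter]
        exact sum_le_sum_of_subset_of_nonneg (filter_subset _ _) fun _ _ _ ↦
          prod_nonneg fun _ _ ↦ by positivity
    _ = (∑ b ∈ A.image ρ, (k : ℝ) ^ Ω b * W b ^ 2) ^ k := by rw [sum_pow']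

theorem prod_natCast_cpow {ι : Type*} (s : Finset ι) (f : ι → ℕ) (z : ℂ) :
    ∏ i ∈ s, (f i : ℂ) ^ z = ((∏ i ∈ s, f i : ℕ) : ℂ) ^ z := by
  classical
  induction s using Finset.induction_on with
  | empty => simp
  | insert i s hi ih =>
    rw [prod_insert hi, prod_insert hi, ih, Nat.cast_mul, Complex.natCast_mul_natCast_cpow]

theorem sum_natCast_cpow_pow (A : Finset ℕ) (k : ℕ) (z : ℂ) :
    (∑ n ∈ A, (n : ℂ) ^ z) ^ k =
      ∑ m ∈ (Fintype.piFinset fun _ : Fin k ↦ A).image fun ν ↦ ∏ i, ν i,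
        (tupleCount A k m : ℂ) * (m : ℂ) ^ z := by
  rw [sum_pow', ← sum_fiberwise_of_maps_to fun ν hν ↦
    mem_image_of_mem (fun ν : Fin k → ℕ ↦ ∏ i, ν i) hν]
  refine sum_congr rfl fun m _ ↦ ?_
  rw [tupleCount, ← nsmul_eq_mul, ← sum_const]
  refine sum_congr rfl fun ν hν ↦ ?_
  rw [prod_natCast_cpow, (mem_filter.1 hν).2]

theorem natCast_cpow_I_mul {m : ℕ} (hm : m ≠ 0) (t : ℝ) :
    (m : ℂ) ^ (Complex.I * (t : ℂ)) = Complex.exp (Complex.I * (log m : ℝ) * t) := by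
  rw [Complex.cpow_def_of_ne_zero (by exact_mod_cast hm), Complex.natCast_log]
  congr 1
  ring

/-! ### Gaussian mean values and large values -/

section Gaussian

variable {T : ℝ} {ι : Type*}

theorem ofReal_gaussian_mul_cexp (T c t : ℝ) :
    ((exp (-(t / T) ^ 2) : ℝ) : ℂ) * Complex.exp (Complex.I * c * t) =
      Complex.exp (-((1 / T ^ 2 : ℝ) : ℂ) * (t : ℂ) ^ 2 + Complex.I * c * t + 0) := by
  rw [Complex.ofReal_exp, ← Complex.exp_add]
  congr 1
  push_cast
  ring

theorem integrable_gaussian_mul_cexp (hT : 0 < T) (c : ℝ) :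
    Integrable fun t : ℝ ↦ ((exp (-(t / T) ^ 2) : ℝ) : ℂ) * Complex.exp (Complex.I * c * t) := by
  simp only [ofReal_gaussian_mul_cexp]
  exact integrable_cexp_quadratic (by rw [Complex.ofReal_re]; positivity) _ _

theorem integral_gaussian_mul_cexp (hT : 0 < T) (c : ℝ) :
    ∫ t : ℝ, ((exp (-(t / T) ^ 2) : ℝ) : ℂ) * Complex.exp (Complex.I * c * t) =
      ((√π * T * exp (-(T ^ 2 * c ^ 2 / 4)) : ℝ) : ℂ) := by
  have hre : 0 < ((1 / T ^ 2 : ℝ) : ℂ).re := by rw [Complex.ofReal_re]; positivity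
  have hsqrt : ((π : ℂ) / ((1 / T ^ 2 : ℝ) : ℂ)) ^ (1 / 2 : ℂ) = ((√π * T : ℝ) : ℂ) := by
    rw [← Complex.ofReal_div, show (1 / 2 : ℂ) = ((1 / 2 : ℝ) : ℂ) by push_cast; rfl,
      ← Complex.ofReal_cpow (by positivity), ← sqrt_eq_rpow, div_div_eq_mul_div, div_one,
      sqrt_mul pi_pos.le, sqrt_sq hT.le]
  have hexp : -(c : ℂ) ^ 2 / (4 * ((1 / T ^ 2 : ℝ) : ℂ)) =
      ((-(T ^ 2 * c ^ 2 / 4) : ℝ) : ℂ) := by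
    push_cast
    field_simp
  have hcomm (t : ℝ) : ((exp (-(t / T) ^ 2) : ℝ) : ℂ) * Complex.exp (Complex.I * c * t) =
      Complex.exp (Complex.I * c * t) * Complex.exp (-((1 / T ^ 2 : ℝ) : ℂ) * (t : ℂ) ^ 2) := by
    rw [ofReal_gaussian_mul_cexp, ← Complex.exp_add]
    congr 1
    ring
  simp only [hcomm]
  rw [fourierIntegral_gaussian hre, hsqrt, hexp, ← Complex.ofReal_exp, ← Complex.ofReal_mul]

theorem ofReal_gaussian_mul_norm_sum_sq (T t : ℝ) (s : Finset ι) (a u : ι → ℝ) :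
    ((exp (-(t / T) ^ 2) * ‖∑ i ∈ s, (a i : ℂ) * Complex.exp (Complex.I * u i * t)‖ ^ 2 : ℝ) : ℂ) =
      ∑ i ∈ s, ∑ j ∈ s, ((a i * a j : ℝ) : ℂ) *
        (((exp (-(t / T) ^ 2) : ℝ) : ℂ) * Complex.exp (Complex.I * ((u i - u j : ℝ) : ℂ) * t)) := by
  rw [Complex.ofReal_mul, Complex.ofReal_pow, ← Complex.mul_conj', map_sum, sum_mul_sum]
  simp only [mul_sum]
  refine sum_congr rfl fun i _ ↦ sum_congr rfl fun j _ ↦ ?_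
  have hsplit : Complex.exp (Complex.I * ((u i - u j : ℝ) : ℂ) * t) =
      Complex.exp (Complex.I * u i * t) * Complex.exp (-Complex.I * u j * t) := by
    rw [← Complex.exp_add]
    congr 1
    push_cast
    ring
  simp only [map_mul, Complex.conj_ofReal, ← Complex.exp_conj, Complex.conj_I]
  rw [hsplit, Complex.ofReal_mul]
  ring

theorem integrable_gaussian_mul_norm_sum_sq (hT : 0 < T) (s : Finset ι) (a u : ι → ℝ) :
    Integrable fun t : ℝ ↦
      exp (-(t / T) ^ 2) * ‖∑ i ∈ s, (a i : ℂ) * Complex.exp (Complex.I * u i * t)‖ ^ 2 := by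
  have hfint : Integrable fun t : ℝ ↦ ((exp (-(t / T) ^ 2) *
      ‖∑ i ∈ s, (a i : ℂ) * Complex.exp (Complex.I * u i * t)‖ ^ 2 : ℝ) : ℂ) := by
    simp only [ofReal_gaussian_mul_norm_sum_sq]
    exact integrable_finsetSum _ fun i _ ↦ integrable_finsetSum _ fun j _ ↦
      (integrable_gaussian_mul_cexp hT _).const_mul _
  simpa only [RCLike.re_to_complex, Complex.ofReal_re] using hfint.re

theorem integral_gaussian_mul_norm_sum_sq (hT : 0 < T) (s : Finset ι) (a u : ι → ℝ) :
    ∫ t : ℝ, exp (-(t / T) ^ 2) *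
        ‖∑ i ∈ s, (a i : ℂ) * Complex.exp (Complex.I * u i * t)‖ ^ 2 =
      √π * T * ∑ i ∈ s, ∑ j ∈ s, a i * a j * exp (-(T ^ 2 * (u i - u j) ^ 2 / 4)) := by
  have hfint (i j : ι) := (integrable_gaussian_mul_cexp hT (u i - u j)).const_mul
    ((a i * a j : ℝ) : ℂ)
  apply Complex.ofReal_injective
  rw [← integral_complex_ofReal]
  simp_rw [ofReal_gaussian_mul_norm_sum_sq]
  rw [integral_finsetSum _ fun i _ ↦ integrable_finsetSum _ fun j _ ↦ hfint i j]
  simp_rw [integral_finsetSum s fun j _ ↦ hfint _ j, integral_const_mul,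
    integral_gaussian_mul_cexp hT, ← Complex.ofReal_mul, ← Complex.ofReal_sum, mul_sum]
  exact congrArg _ (sum_congr rfl fun i _ ↦ sum_congr rfl fun j _ ↦ by ring)

end Gaussian

theorem abs_sub_le_mul_abs_log_sub_log {m n T : ℝ} (hm : 0 < m) (hn : 0 < n) (hmT : m ≤ T)
    (hnT : n ≤ T) : |m - n| ≤ T * |log m - log n| := by
  wlog h : m ≤ n generalizing m n
  · rw [abs_sub_comm, abs_sub_comm (log m)]
    exact this hn hm hnT hmT (by linarith)
  have hl := one_sub_inv_le_log_of_pos (div_pos hn hm)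
  rw [log_div hn.ne' hm.ne', inv_div] at hl
  have hle : 0 ≤ log n - log m := by linarith [log_le_log hm h]
  rw [abs_sub_comm, abs_of_nonneg (by linarith), abs_sub_comm, abs_of_nonneg hle]
  calc n - m = n * (1 - m / n) := by field_simp
    _ ≤ n * (log n - log m) := by gcongr
    _ ≤ T * (log n - log m) := by gcongr

theorem summable_exp_neg_int_sq : Summable fun j : ℤ ↦ exp (-((j : ℝ) ^ 2 / 4)) := by
  have hnat : Summable fun n : ℕ ↦ exp (-((n : ℝ) ^ 2 / 4)) := by
    refine .of_nonneg_of_le (fun _ ↦ by positivity) (fun n ↦ ?_)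
      (summable_exp_neg_nat.mul_left (exp 1))
    rw [← exp_add]
    exact exp_le_exp.2 (by nlinarith [sq_nonneg ((n : ℝ) - 2)])
  exact .of_nat_of_neg (by simpa using hnat) (by simpa using hnat)

theorem sum_exp_neg_sub_sq_le (s : Finset ℕ) (m : ℕ) :
    ∑ n ∈ s, exp (-(((m : ℝ) - n) ^ 2 / 4)) ≤ ∑' j : ℤ, exp (-((j : ℝ) ^ 2 / 4)) := by
  have hinj : Set.InjOn (fun n : ℕ ↦ (m : ℤ) - n) s := fun _ _ _ _ h ↦ by simpa using h
  calc ∑ n ∈ s, exp (-(((m : ℝ) - n) ^ 2 / 4))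
      = ∑ j ∈ s.image fun n : ℕ ↦ (m : ℤ) - n, exp (-((j : ℝ) ^ 2 / 4)) := by
        rw [sum_image hinj]
        simp
    _ ≤ ∑' j : ℤ, exp (-((j : ℝ) ^ 2 / 4)) :=
        summable_exp_neg_int_sq.sum_le_tsum _ fun _ _ ↦ by positivity

theorem sum_sum_mul_mul_le_of_row_sum_le {ι : Type*} {s : Finset ι} {E : ι → ι → ℝ} {κ : ℝ}
    (hE : ∀ i j, 0 ≤ E i j) (hsymm : ∀ i j, E i j = E j i) (hrow : ∀ i ∈ s, ∑ j ∈ s, E i j ≤ κ)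
    (a : ι → ℝ) : ∑ i ∈ s, ∑ j ∈ s, a i * a j * E i j ≤ κ * ∑ i ∈ s, a i ^ 2 := by
  have hswap : ∑ i ∈ s, ∑ j ∈ s, a j ^ 2 * E i j = ∑ i ∈ s, ∑ j ∈ s, a i ^ 2 * E i j := by
    rw [sum_comm]
    simp_rw [hsymm]
  calc ∑ i ∈ s, ∑ j ∈ s, a i * a j * E i j
      ≤ ∑ i ∈ s, ∑ j ∈ s, (a i ^ 2 * E i j + a j ^ 2 * E i j) / 2 :=
        sum_le_sum fun i _ ↦ sum_le_sum fun j _ ↦ by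
          nlinarith [mul_nonneg (sq_nonneg (a i - a j)) (hE i j)]
    _ = ∑ i ∈ s, a i ^ 2 * ∑ j ∈ s, E i j := by
        simp_rw [← sum_div, sum_add_distrib, hswap, mul_sum]
        ring
    _ ≤ ∑ i ∈ s, a i ^ 2 * κ :=
        sum_le_sum fun i hi ↦ mul_le_mul_of_nonneg_left (hrow i hi) (sq_nonneg _)
    _ = κ * ∑ i ∈ s, a i ^ 2 := by rw [← sum_mul, mul_comm]

theorem exists_integral_gaussian_mul_norm_sq_le : ∃ K : ℝ, 1 ≤ K ∧ ∀ (T : ℝ) (s : Finset ℕ)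
    (a : ℕ → ℝ), 0 < T → (∀ m ∈ s, m ≠ 0 ∧ (m : ℝ) ≤ T) → (∀ m, 0 ≤ a m) →
    ∫ t : ℝ, exp (-(t / T) ^ 2) *
        ‖∑ m ∈ s, (a m : ℂ) * Complex.exp (Complex.I * (log m : ℝ) * t)‖ ^ 2 ≤
      K * T * ∑ m ∈ s, a m ^ 2 := by
  set κ : ℝ := ∑' j : ℤ, exp (-((j : ℝ) ^ 2 / 4))
  refine ⟨max 1 (√π * κ), le_max_left _ _, fun T s a hT hs ha ↦ ?_⟩
  have hsq : ∀ m ∈ s, ∀ n ∈ s, ((m : ℝ) - n) ^ 2 ≤ T ^ 2 * (log m - log n) ^ 2 :=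
    fun m hm n hn ↦ by
    have hlog := abs_sub_le_mul_abs_log_sub_log (mod_cast Nat.pos_of_ne_zero (hs m hm).1)
      (mod_cast Nat.pos_of_ne_zero (hs n hn).1) (hs m hm).2 (hs n hn).2
    rw [← sq_abs, ← sq_abs (log m - log n), ← mul_pow]
    exact pow_le_pow_left₀ (abs_nonneg _) hlog 2
  calc ∫ t : ℝ, exp (-(t / T) ^ 2) *
        ‖∑ m ∈ s, (a m : ℂ) * Complex.exp (Complex.I * (log m : ℝ) * t)‖ ^ 2
      = √π * T * ∑ m ∈ s, ∑ n ∈ s, a m * a n * exp (-(T ^ 2 * (log m - log n) ^ 2 / 4)) :=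
        integral_gaussian_mul_norm_sum_sq hT s a fun m ↦ log m
    _ ≤ √π * T * ∑ m ∈ s, ∑ n ∈ s, a m * a n * exp (-(((m : ℝ) - n) ^ 2 / 4)) := by
        gcongr with m hm n hn
        · exact mul_nonneg (ha m) (ha n)
        · exact hsq m hm n hn
    _ ≤ √π * T * (κ * ∑ m ∈ s, a m ^ 2) := by
        gcongr
        exact sum_sum_mul_mul_le_of_row_sum_le (fun _ _ ↦ (exp_pos _).le)
          (fun m n ↦ by rw [← neg_sub, neg_sq]) (fun m _ ↦ sum_exp_neg_sub_sq_le s m) a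
    _ = √π * κ * (T * ∑ m ∈ s, a m ^ 2) := by ring
    _ ≤ max 1 (√π * κ) * (T * ∑ m ∈ s, a m ^ 2) := by
        gcongr
        exact le_max_right _ _
    _ = max 1 (√π * κ) * T * ∑ m ∈ s, a m ^ 2 := (mul_assoc _ _ _).symm

theorem volume_le_norm_le_of_integral_gaussian_le {T J μ : ℝ} {F : ℝ → ℂ} (hT : 0 < T) (hμ : 0 < μ)
    (hfint : Integrable fun t ↦ exp (-(t / T) ^ 2) * ‖F t‖ ^ 2)
    (hJ : ∫ t, exp (-(t / T) ^ 2) * ‖F t‖ ^ 2 ≤ J) :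
    volume {t | t ∈ Set.Icc 1 T ∧ μ ≤ ‖F t‖} ≤ ENNReal.ofReal (exp 1 * J / μ ^ 2) := by
  set f : ℝ → ℝ := fun t ↦ exp (-(t / T) ^ 2) * ‖F t‖ ^ 2
  set ε : ℝ := exp (-1) * μ ^ 2 with hε
  have hε0 : 0 < ε := by positivity
  have hmarkov := meas_ge_le_lintegral_div (μ := volume) (f := fun t ↦ ENNReal.ofReal (f t))
    hfint.aemeasurable.ennreal_ofReal (ε := ENNReal.ofReal ε) (by simpa using hε0)
    ENNReal.ofReal_ne_top
  rw [← ofReal_integral_eq_lintegral_ofReal hfint (.of_forall fun t ↦ by positivity),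
    ← ENNReal.ofReal_div_of_pos hε0] at hmarkov
  refine (measure_mono ?_).trans (hmarkov.trans (ENNReal.ofReal_le_ofReal ?_))
  · rintro t ⟨⟨ht1, htT⟩, ht⟩
    have hgauss : exp (-1) ≤ exp (-(t / T) ^ 2) :=
      exp_le_exp.2 (neg_le_neg (pow_le_one₀ (by positivity) ((div_le_one hT).2 htT)))
    exact ENNReal.ofReal_le_ofReal
      (mul_le_mul hgauss (pow_le_pow_left₀ hμ.le ht 2) (by positivity) (by positivity))
  · rw [div_le_iff₀ hε0, hε, exp_neg]
    refine hJ.trans_eq ?_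
    field_simp

/-- The multiplicative model `ρ` only has to dominate the moments: the bound is the `2k`-th moment
of the Dirichlet polynomial divided by `lam ^ (2 * k)`. -/
theorem exists_volume_large_values_le : ∃ K : ℝ, 1 ≤ K ∧ ∀ (T x : ℝ) (A : Finset ℕ) (ρ : ℕ →* ℕ)
    (k : ℕ) (B lam : ℝ), 0 < T → x ^ k ≤ T → (∀ n ∈ A, n ≠ 0 ∧ (n : ℝ) ≤ x) →
    (∀ n ∈ A, ρ n ≠ 0) →
    ∑ b ∈ A.image ρ, (k : ℝ) ^ Ω b * (#{n ∈ A | ρ n = b} : ℝ) ^ 2 ≤ B → 0 < lam →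
    volume {t : ℝ | t ∈ Set.Icc 1 T ∧ lam < ‖∑ n ∈ A, (n : ℂ) ^ (Complex.I * (t : ℂ))‖} ≤
      ENNReal.ofReal (K * T * (B / lam ^ 2) ^ k) := by
  obtain ⟨K, hK, hKle⟩ := exists_integral_gaussian_mul_norm_sq_le
  refine ⟨K * exp 1, by nlinarith [one_le_exp zero_le_one], ?_⟩
  intro T x A ρ k B lam hT hxT hA hρ hB hlam
  set s : Finset ℕ := (Fintype.piFinset fun _ : Fin k ↦ A).image fun ν ↦ ∏ i, ν i with hs
  set a : ℕ → ℝ := fun m ↦ tupleCount A k m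
  have hsT : ∀ m ∈ s, m ≠ 0 ∧ (m : ℝ) ≤ T := fun m hm ↦ by
    obtain ⟨ν, hν, rfl⟩ := mem_image.1 hm
    rw [Fintype.mem_piFinset] at hν
    refine ⟨prod_ne_zero_iff.2 fun i _ ↦ (hA _ (hν i)).1, le_trans ?_ hxT⟩
    rw [Nat.cast_prod]
    calc ∏ i, (ν i : ℝ) ≤ ∏ _i : Fin k, x :=
          prod_le_prod (fun _ _ ↦ Nat.cast_nonneg _) fun i _ ↦ (hA _ (hν i)).2
      _ = x ^ k := by simp
  have hpow (t : ℝ) : (∑ n ∈ A, (n : ℂ) ^ (Complex.I * (t : ℂ))) ^ k =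
      ∑ m ∈ s, (a m : ℂ) * Complex.exp (Complex.I * (log m : ℝ) * t) := by
    rw [sum_natCast_cpow_pow, ← hs]
    refine sum_congr rfl fun m hm ↦ ?_
    rw [natCast_cpow_I_mul (hsT m hm).1, Complex.ofReal_natCast]
  have hmoment : ∫ t : ℝ, exp (-(t / T) ^ 2) *
      ‖∑ m ∈ s, (a m : ℂ) * Complex.exp (Complex.I * (log m : ℝ) * t)‖ ^ 2 ≤ K * T * B ^ k := by
    refine (hKle T s a hT hsT fun m ↦ Nat.cast_nonneg _).trans ?_
    gcongr
    exact (sum_tupleCount_sq_le ρ hρ k s).trans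
      (pow_le_pow_left₀ (sum_nonneg fun _ _ ↦ by positivity) hB k)
  refine (measure_mono ?_).trans ((volume_le_norm_le_of_integral_gaussian_le hT (pow_pos hlam k)
    (integrable_gaussian_mul_norm_sum_sq hT s a fun m ↦ log m) hmoment).trans_eq ?_)
  · rintro t ⟨htT, ht⟩
    refine ⟨htT, ?_⟩
    rw [← hpow, norm_pow]
    exact pow_le_pow_left₀ hlam.le ht.le k
  · congr 1
    rw [div_pow, ← pow_mul, ← pow_mul, mul_comm 2 k]
    ring

/-! ### Rough parts and Euler products -/

section CompletelyMul

variable {M : Type*} [CommMonoidWithZero M]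

/-- The completely multiplicative function with prescribed values at the primes; it vanishes
at `0`. -/
noncomputable def completelyMul (φ : ℕ → M) : ℕ →* M where
  toFun n := if n = 0 then 0 else (n.primeFactorsList.map φ).prod
  map_one' := by simp
  map_mul' m n := by
    rcases eq_or_ne m 0 with rfl | hm
    · simp
    rcases eq_or_ne n 0 with rfl | hn
    · simp
    rw [if_neg (mul_ne_zero hm hn), if_neg hm, if_neg hn,
      ((Nat.perm_primeFactorsList_mul hm hn).map φ).prod_eq, List.map_append, List.prod_append]

theorem completelyMul_zero (φ : ℕ → M) : completelyMul φ 0 = 0 := by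
  simp [completelyMul]

theorem completelyMul_prime (φ : ℕ → M) {p : ℕ} (hp : p.Prime) : completelyMul φ p = φ p := by
  simp [completelyMul, hp.ne_zero, Nat.primeFactorsList_prime hp]

end CompletelyMul

theorem completelyMul_nonneg {φ : ℕ → ℝ} {n : ℕ} (h : ∀ p, p.Prime → p ∣ n → 0 ≤ φ p) :
    0 ≤ completelyMul φ n := by
  induction n using induction_on_primes with
  | zero => rw [completelyMul_zero]
  | one => rw [map_one]; exact zero_le_one
  | prime_mul p a hp ih =>
    rw [map_mul, completelyMul_prime φ hp]
    exact mul_nonneg (h p hp (dvd_mul_right p a)) (ih fun q hq hqa ↦ h q hq (hqa.mul_left p))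

theorem inv_one_sub_le_exp_two_mul {u : ℝ} (h0 : 0 ≤ u) (h1 : u ≤ 1 / 2) :
    (1 - u)⁻¹ ≤ exp (2 * u) := by
  refine le_trans ?_ (add_one_le_exp (2 * u))
  rw [inv_le_iff_one_le_mul₀ (by linarith)]
  nlinarith

theorem sum_completelyMul_le {S : Finset ℕ} (hS : ∀ p ∈ S, p.Prime) {φ : ℕ → ℝ}
    (h0 : ∀ p, 0 ≤ φ p) (h1 : ∀ p, φ p ≤ 1 / 2) (R : Finset ℕ)
    (hR : ∀ b ∈ R, b ≠ 0 ∧ ∀ p : ℕ, p.Prime → p ∣ b → p ∈ S) :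
    ∑ b ∈ R, completelyMul φ b ≤ exp (2 * ∑ p ∈ S, φ p) := by
  have hEuler := EulerProduct.summable_and_hasSum_factoredNumbers_prod_filter_prime_geometric
    (f := completelyMul φ) (fun {p} hp ↦ by
      rw [completelyMul_prime φ hp, norm_eq_abs, abs_of_nonneg (h0 p)]; linarith [h1 p]) S
  have hmem : ∀ b ∈ R, b ∈ Nat.factoredNumbers S := fun b hb ↦
    Nat.mem_factoredNumbers_iff_forall_le.2 ⟨(hR b hb).1, fun p _ ↦ (hR b hb).2 p⟩
  calc ∑ b ∈ R, completelyMul φ b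
      = ∑ b ∈ R.subtype (· ∈ Nat.factoredNumbers S), completelyMul φ (b : ℕ) := by
        rw [sum_subtype_of_mem _ hmem]
    _ ≤ ∏ p ∈ S with p.Prime, (1 - completelyMul φ p)⁻¹ :=
        sum_le_hasSum _ (fun b _ ↦ completelyMul_nonneg fun p _ _ ↦ h0 p) hEuler.2
    _ = ∏ p ∈ S, (1 - φ p)⁻¹ := by
        rw [filter_true_of_mem hS]
        exact prod_congr rfl fun p hp ↦ by rw [completelyMul_prime φ (hS p hp)]
    _ ≤ ∏ p ∈ S, exp (2 * φ p) :=
        prod_le_prod (fun p _ ↦ inv_nonneg.2 (by linarith [h1 p]))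
          fun p _ ↦ inv_one_sub_le_exp_two_mul (h0 p) (h1 p)
    _ = exp (2 * ∑ p ∈ S, φ p) := by rw [mul_sum, exp_sum]

/-- The largest divisor of `n` all of whose prime factors exceed `y`, as a completely
multiplicative function of `n`; its value at `0` is `0`. -/
noncomputable def roughPart (y : ℝ) : ℕ →* ℕ :=
  completelyMul fun p ↦ if y < p then p else 1

theorem roughPart_prime (y : ℝ) {p : ℕ} (hp : p.Prime) :
    roughPart y p = if y < p then p else 1 :=
  completelyMul_prime _ hp

theorem exists_eq_roughPart_mul (y : ℝ) {n : ℕ} (hn : n ≠ 0) :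
    ∃ m, n = roughPart y n * m ∧ IsFriable y m := by
  induction n using induction_on_primes with
  | zero => exact absurd rfl hn
  | one => exact ⟨1, by simp, isFriable_one y⟩
  | prime_mul p a hp ih =>
    obtain ⟨m, ha, hm⟩ := ih (right_ne_zero_of_mul hn)
    rw [map_mul, roughPart_prime y hp]
    split_ifs with hpy
    · exact ⟨m, by rw [mul_assoc, ← ha], hm⟩
    · exact ⟨p * m, by rw [one_mul, mul_left_comm, ← ha],
        (isFriable_of_le hp.ne_zero (not_lt.1 hpy)).mul hm⟩

theorem roughPart_ne_zero (y : ℝ) {n : ℕ} (hn : n ≠ 0) : roughPart y n ≠ 0 := by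
  obtain ⟨m, hm, -⟩ := exists_eq_roughPart_mul y hn
  exact left_ne_zero_of_mul (hm ▸ hn)

theorem roughPart_le (y : ℝ) (n : ℕ) : roughPart y n ≤ n := by
  rcases eq_or_ne n 0 with rfl | hn
  · exact (completelyMul_zero _).le
  · obtain ⟨m, hm, -⟩ := exists_eq_roughPart_mul y hn
    exact Nat.le_of_dvd (Nat.pos_of_ne_zero hn) ⟨m, hm⟩

theorem lt_of_prime_dvd_roughPart {y : ℝ} {n p : ℕ} (hn : n ≠ 0) (hp : p.Prime)
    (h : p ∣ roughPart y n) : y < p := by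
  induction n using induction_on_primes with
  | zero => exact absurd rfl hn
  | one => exact absurd (by simpa using h) hp.ne_one
  | prime_mul q a hq ih =>
    rw [map_mul, hp.dvd_mul, roughPart_prime y hq] at h
    rcases h with h | h
    · split_ifs at h with hqy
      · rwa [(Nat.prime_dvd_prime_iff_eq hp hq).1 h]
      · exact absurd (Nat.dvd_one.1 h) hp.ne_one
    · exact ih (right_ne_zero_of_mul hn) h

theorem isFriable_of_roughPart_eq_one {y : ℝ} {n : ℕ} (hn : n ≠ 0) (h : roughPart y n = 1) :
    IsFriable y n := by
  obtain ⟨m, hm, hfr⟩ := exists_eq_roughPart_mul y hn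
  rwa [hm, h, one_mul]

theorem card_filter_roughPart_le {x y : ℝ} {A : Finset ℕ} (hA : ∀ n ∈ A, n ≠ 0 ∧ (n : ℝ) ≤ x)
    (b : ℕ) : (#{n ∈ A | roughPart y n = b} : ℝ) ≤ friableCount (x / b) y := by
  have hdecomp : ∀ n ∈ {n ∈ A | roughPart y n = b},
      b * (n / b) = n ∧ n / b ∈ friableUpTo (x / b) y := by
    intro n hn
    obtain ⟨hnA, rfl⟩ := mem_filter.1 hn
    obtain ⟨m, hm, hfr⟩ := exists_eq_roughPart_mul y (hA n hnA).1
    have hpos := Nat.pos_of_ne_zero (roughPart_ne_zero y (hA n hnA).1)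
    have hdiv : n / roughPart y n = m := Nat.div_eq_of_eq_mul_right hpos hm
    rw [hdiv, mem_friableUpTo, le_div_iff₀' (mod_cast hpos)]
    exact ⟨hm.symm, by exact_mod_cast hm ▸ (hA n hnA).2, hfr⟩
  refine Nat.cast_le.2 (card_le_card_of_injOn (· / b) (fun n hn ↦ (hdecomp n hn).2) ?_)
  intro n hn n' hn' (h : n / b = n' / b)
  rw [← (hdecomp n hn).1, h, (hdecomp n' hn').1]

/-! ### Large values of zeta sums -/

theorem pow_cardFactors_mul_friableCount_sq_le {X y : ℝ} {k : ℕ} {φ : ℕ → ℝ} {b : ℕ} (hb : b ≠ 0)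
    (hφ : ∀ p : ℕ, p.Prime → p ∣ b → φ p = k * friableRatio X y p ^ 2) {x : ℝ} (hx : x ≤ X)
    (hx0 : 0 ≤ x) :
    (k : ℝ) ^ Ω b * friableCount (x / b) y ^ 2 ≤ completelyMul φ b * friableCount x y ^ 2 := by
  induction b using induction_on_primes generalizing x with
  | zero => exact absurd rfl hb
  | one => simp
  | prime_mul p a hp ih =>
    have ha : a ≠ 0 := right_ne_zero_of_mul hb
    have hp1 : (1 : ℝ) ≤ p := mod_cast hp.one_lt.le
    have hφa (q : ℕ) (hq : q.Prime) (hqa : q ∣ a) := hφ q hq (hqa.mul_left p)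
    have hnonneg : 0 ≤ completelyMul φ a := completelyMul_nonneg fun q hq hqa ↦ by
      rw [hφa q hq hqa]; positivity
    rw [ArithmeticFunction.cardFactors_mul hp.ne_zero ha,
      ArithmeticFunction.cardFactors_apply_prime hp, pow_add, pow_one, map_mul,
      completelyMul_prime φ hp, hφ p hp (dvd_mul_right p a), Nat.cast_mul, ← div_div]
    calc (k : ℝ) * k ^ Ω a * friableCount (x / p / a) y ^ 2
        = k * (k ^ Ω a * friableCount (x / p / a) y ^ 2) := by ring
      _ ≤ k * (completelyMul φ a * friableCount (x / p) y ^ 2) :=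
          mul_le_mul_of_nonneg_left (ih ha hφa ((div_le_self hx0 hp1).trans hx) (by positivity))
            (Nat.cast_nonneg k)
      _ ≤ k * (completelyMul φ a * (friableRatio X y p * friableCount x y) ^ 2) := by
          gcongr
          · exact friableCount_nonneg _ _
          · exact friableCount_div_le hp1 hx
      _ = k * friableRatio X y p ^ 2 * completelyMul φ a * friableCount x y ^ 2 := by ring

theorem sum_pow_cardFactors_mul_friableCount_sq_le {x y : ℝ} {k : ℕ} (hx : 1 ≤ x) (hy : 0 ≤ y)
    (hhalf : ∀ p ∈ primesIoc y x, k * friableRatio x y p ^ 2 ≤ 1 / 2) {R : Finset ℕ}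
    (hR : ∀ b ∈ R, b ≠ 0 ∧ (b : ℝ) ≤ x ∧ ∀ p : ℕ, p.Prime → p ∣ b → y < p) :
    ∑ b ∈ R, (k : ℝ) ^ Ω b * friableCount (x / b) y ^ 2 ≤
      exp (2 * (k * ∑ p ∈ primesIoc y x, friableRatio x y p ^ 2)) * friableCount x y ^ 2 := by
  classical
  have hx0 : 0 ≤ x := zero_le_one.trans hx
  set S := primesIoc y x
  set φ : ℕ → ℝ := fun p ↦ if p ∈ S then k * friableRatio x y p ^ 2 else 0 with hφ
  have hφS : ∀ p ∈ S, φ p = k * friableRatio x y p ^ 2 := fun p hp ↦ if_pos hp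
  have hφ0 (p : ℕ) : 0 ≤ φ p := by
    simp only [hφ]
    split_ifs <;> positivity
  have hφ1 (p : ℕ) : φ p ≤ 1 / 2 := by
    simp only [hφ]
    split_ifs with h
    exacts [hhalf p h, by norm_num]
  have hRS : ∀ b ∈ R, b ≠ 0 ∧ ∀ p : ℕ, p.Prime → p ∣ b → p ∈ S := fun b hb ↦ by
    obtain ⟨hb0, hbx, hrough⟩ := hR b hb
    refine ⟨hb0, fun p hp hpb ↦ (mem_primesIoc hy hx0).2 ⟨hp, hrough p hp hpb, le_trans ?_ hbx⟩⟩
    exact_mod_cast Nat.le_of_dvd (Nat.pos_of_ne_zero hb0) hpb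
  calc ∑ b ∈ R, (k : ℝ) ^ Ω b * friableCount (x / b) y ^ 2
      ≤ ∑ b ∈ R, completelyMul φ b * friableCount x y ^ 2 :=
        sum_le_sum fun b hb ↦ pow_cardFactors_mul_friableCount_sq_le (hRS b hb).1
          (fun p hp hpb ↦ hφS p ((hRS b hb).2 p hp hpb)) le_rfl hx0
    _ = (∑ b ∈ R, completelyMul φ b) * friableCount x y ^ 2 := by rw [sum_mul]
    _ ≤ exp (2 * ∑ p ∈ S, φ p) * friableCount x y ^ 2 := by
        gcongr
        exact sum_completelyMul_le (fun p hp ↦ ((mem_primesIoc hy hx0).1 hp).1) hφ0 hφ1 R hRS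
    _ = exp (2 * (k * ∑ p ∈ S, friableRatio x y p ^ 2)) * friableCount x y ^ 2 := by
        rw [sum_congr rfl hφS, ← mul_sum S]

theorem exists_sum_pow_cardFactors_mul_friableCount_sq_le : ∃ C : ℝ, 1 ≤ C ∧
    ∀ (x y : ℝ) (k : ℕ) (R : Finset ℕ), 1 ≤ x → 2 ≤ y → C * log x ^ 2 ≤ y →
      C * k * log x ^ 2 ≤ y ^ 2 →
      (∀ b ∈ R, b ≠ 0 ∧ (b : ℝ) ≤ x ∧ ∀ p : ℕ, p.Prime → p ∣ b → y < p) →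
      ∑ b ∈ R, (k : ℝ) ^ Ω b * friableCount (x / b) y ^ 2 ≤
        exp (C * k * log x ^ 2 * log y / y) * friableCount x y ^ 2 := by
  obtain ⟨C₁, -, hratio⟩ := exists_friableRatio_le_mul_log_div
  obtain ⟨C₂, hC₂, hsum⟩ := exists_sum_friableRatio_sq_le
  refine ⟨2 * C₁ ^ 2 + 2 * C₂, by nlinarith [sq_nonneg C₁], fun x y k R hx hy hCy hCk hR ↦ ?_⟩
  have hlogy : 0 ≤ log y := log_nonneg (by linarith)
  have hhalf : ∀ p ∈ primesIoc y x, k * friableRatio x y p ^ 2 ≤ 1 / 2 := fun p hp ↦ by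
    have hyp := ((mem_primesIoc (by linarith) (by linarith)).1 hp).2.1
    have hle : friableRatio x y p ≤ C₁ * log x / y :=
      (friableRatio_anti hx (by linarith) hyp.le).trans (hratio x y y hx hy le_rfl)
    calc k * friableRatio x y p ^ 2 ≤ k * (C₁ * log x / y) ^ 2 := by
          gcongr
          exact friableRatio_nonneg _ _ _
      _ = C₁ ^ 2 * k * log x ^ 2 / y ^ 2 := by ring
      _ ≤ 1 / 2 := by
          rw [div_le_iff₀ (by positivity)]
          have : 0 ≤ C₂ * k * log x ^ 2 := by positivity
          linarith
  refine (sum_pow_cardFactors_mul_friableCount_sq_le hx (by linarith) hhalf hR).trans ?_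
  gcongr
  calc 2 * (k * ∑ p ∈ primesIoc y x, friableRatio x y p ^ 2)
      ≤ 2 * (k * (C₂ * log x ^ 2 * log y / y)) := by
        gcongr
        exact hsum x y hx hy (by nlinarith)
    _ = 2 * C₂ * (k * log x ^ 2 * log y / y) := by ring
    _ ≤ (2 * C₁ ^ 2 + 2 * C₂) * (k * log x ^ 2 * log y / y) := by
        gcongr
        linarith [sq_nonneg C₁]
    _ = (2 * C₁ ^ 2 + 2 * C₂) * k * log x ^ 2 * log y / y := by ring

theorem mem_image_roughPart {x y : ℝ} {A : Finset ℕ} (hA : ∀ n ∈ A, n ≠ 0 ∧ (n : ℝ) ≤ x) :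
    ∀ b ∈ A.image (roughPart y), b ≠ 0 ∧ (b : ℝ) ≤ x ∧ ∀ p : ℕ, p.Prime → p ∣ b → y < p := by
  intro b hb
  obtain ⟨n, hn, rfl⟩ := mem_image.1 hb
  obtain ⟨hn0, hnx⟩ := hA n hn
  exact ⟨roughPart_ne_zero y hn0, (Nat.cast_le.2 (roughPart_le y n)).trans hnx,
    fun p ↦ lt_of_prime_dvd_roughPart hn0⟩

theorem exists_volume_sum_cpow_le_of_sum_roughPart_le : ∃ K : ℝ, 1 ≤ K ∧
    ∀ (T x y B lam : ℝ) (k : ℕ) (A : Finset ℕ), 0 < T → x ^ k ≤ T →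
      (∀ n ∈ A, n ≠ 0 ∧ (n : ℝ) ≤ x) →
      ∑ b ∈ A.image (roughPart y), (k : ℝ) ^ Ω b * friableCount (x / b) y ^ 2 ≤ B → 0 < lam →
      volume {t : ℝ | t ∈ Set.Icc 1 T ∧ lam < ‖∑ n ∈ A, (n : ℂ) ^ (Complex.I * (t : ℂ))‖} ≤
        ENNReal.ofReal (K * T * (B / lam ^ 2) ^ k) := by
  obtain ⟨K, hK, hvol⟩ := exists_volume_large_values_le
  refine ⟨K, hK, fun T x y B lam k A hT hxT hA hB hlam ↦ ?_⟩
  refine hvol T x A (roughPart y) k B lam hT hxT hA (fun n hn ↦ roughPart_ne_zero y (hA n hn).1)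
    (le_trans (sum_le_sum fun b _ ↦ ?_) hB) hlam
  gcongr
  exact card_filter_roughPart_le hA b

theorem ne_zero_and_le_of_mem_Icc_floor {x : ℝ} {n : ℕ} (hn : n ∈ Icc 1 ⌊x⌋₊) :
    n ≠ 0 ∧ (n : ℝ) ≤ x := by
  rw [mem_Icc, Nat.one_le_iff_ne_zero] at hn
  exact ⟨hn.1, (Nat.le_floor_iff' hn.1).1 hn.2⟩

theorem exists_volume_zetaSum_le : ∃ K C : ℝ, 1 ≤ K ∧ 1 ≤ C ∧ ∀ (T x y lam : ℝ) (k : ℕ),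
    0 < T → 1 ≤ x → 2 ≤ y → C * log x ^ 2 ≤ y → C * k * log x ^ 2 ≤ y ^ 2 → x ^ k ≤ T → 0 < lam →
    volume {t : ℝ | t ∈ Set.Icc 1 T ∧ lam < ‖zetaSum x t‖} ≤
      ENNReal.ofReal (K * T *
        (exp (C * k * log x ^ 2 * log y / y) * friableCount x y ^ 2 / lam ^ 2) ^ k) := by
  obtain ⟨K, hK, hvol⟩ := exists_volume_sum_cpow_le_of_sum_roughPart_le
  obtain ⟨C, hC, hsum⟩ := exists_sum_pow_cardFactors_mul_friableCount_sq_le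
  refine ⟨K, C, hK, hC, fun T x y lam k hT hx hy hCy hCk hxT hlam ↦ ?_⟩
  have hA : ∀ n ∈ Icc 1 ⌊x⌋₊, n ≠ 0 ∧ (n : ℝ) ≤ x := fun _ ↦ ne_zero_and_le_of_mem_Icc_floor
  exact hvol T x y _ lam k _ hT hxT hA (hsum x y k _ hx hy hCy hCk (mem_image_roughPart hA)) hlam

theorem zetaSum_sub_friableSum (x y t : ℝ) : zetaSum x t - friableSum x y t =
    ∑ n ∈ Icc 1 ⌊x⌋₊ \ friableUpTo x y, (n : ℂ) ^ (Complex.I * (t : ℂ)) := by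
  classical
  rw [zetaSum, friableSum, sub_eq_iff_eq_add]
  exact (sum_sdiff (filter_subset _ _)).symm

theorem exists_volume_zetaSum_sub_friableSum_le : ∃ K C : ℝ, 1 ≤ K ∧ 1 ≤ C ∧
    ∀ (T x y lam : ℝ) (k : ℕ), 0 < T → 1 ≤ x → 2 ≤ y → C * log x ^ 2 ≤ y →
      C * k * log x ^ 2 ≤ y ^ 2 → x ^ k ≤ T → 0 < lam →
      volume {t : ℝ | t ∈ Set.Icc 1 T ∧ lam < ‖zetaSum x t - friableSum x y t‖} ≤
        ENNReal.ofReal (K * T *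
          ((exp (C * k * log x ^ 2 * log y / y) - 1) * friableCount x y ^ 2 / lam ^ 2) ^ k) := by
  obtain ⟨K, hK, hvol⟩ := exists_volume_sum_cpow_le_of_sum_roughPart_le
  obtain ⟨C, hC, hsum⟩ := exists_sum_pow_cardFactors_mul_friableCount_sq_le
  refine ⟨K, C, hK, hC, fun T x y lam k hT hx hy hCy hCk hxT hlam ↦ ?_⟩
  simp only [zetaSum_sub_friableSum]
  have hA : ∀ n ∈ Icc 1 ⌊x⌋₊ \ friableUpTo x y, n ≠ 0 ∧ (n : ℝ) ≤ x := fun n hn ↦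
    ne_zero_and_le_of_mem_Icc_floor (mem_sdiff.1 hn).1
  -- The friable integers are those with rough part `1`, whose contribution `Ψ ^ 2` is saved.
  have hone : 1 ∉ (Icc 1 ⌊x⌋₊ \ friableUpTo x y).image (roughPart y) := fun h ↦ by
    obtain ⟨n, hn, hn1⟩ := mem_image.1 h
    exact (mem_sdiff.1 hn).2 (mem_friableUpTo.2
      ⟨(hA n hn).2, isFriable_of_roughPart_eq_one (hA n hn).1 hn1⟩)
  have hinsert := hsum x y k (insert 1 _) hx hy hCy hCk (forall_mem_insert _ _ _ |>.2
    ⟨⟨one_ne_zero, by simpa using hx, fun p hp hp1 ↦ absurd (Nat.dvd_one.1 hp1) hp.ne_one⟩,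
      mem_image_roughPart hA⟩)
  rw [sum_insert hone, ArithmeticFunction.cardFactors_one, pow_zero, Nat.cast_one, div_one,
    one_mul] at hinsert
  exact hvol T x y _ lam k _ hT hxT hA (by linarith) hlam

/-! ### Approximation of a zeta sum by its friable part -/

theorem norm_sum_natCast_cpow_le {A : Finset ℕ} (hA : ∀ n ∈ A, n ≠ 0) (t : ℝ) :
    ‖∑ n ∈ A, (n : ℂ) ^ (Complex.I * (t : ℂ))‖ ≤ #A := by
  refine (norm_sum_le _ _).trans_eq ?_
  rw [cast_card]
  refine sum_congr rfl fun n hn ↦ ?_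
  simp [Complex.norm_natCast_cpow_of_pos (Nat.pos_of_ne_zero (hA n hn))]

theorem norm_zetaSum_le (x t : ℝ) : ‖zetaSum x t‖ ≤ ⌊x⌋₊ :=
  (norm_sum_natCast_cpow_le (fun _ hn ↦ (ne_zero_and_le_of_mem_Icc_floor hn).1) t).trans
    (by simp)

theorem norm_friableSum_le (x y t : ℝ) : ‖friableSum x y t‖ ≤ friableCount x y :=
  norm_sum_natCast_cpow_le (fun _ hn ↦ (mem_friableUpTo.1 hn).2.1) t

theorem norm_zetaSum_sub_friableSum_le {x : ℝ} (hx : 0 ≤ x) (y t : ℝ) :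
    ‖zetaSum x t - friableSum x y t‖ ≤ 2 * x :=
  calc ‖zetaSum x t - friableSum x y t‖ ≤ ‖zetaSum x t‖ + ‖friableSum x y t‖ := norm_sub_le _ _
    _ ≤ x + x := add_le_add ((norm_zetaSum_le x t).trans (Nat.floor_le hx))
        ((norm_friableSum_le x y t).trans (friableCount_le_self hx y))
    _ = 2 * x := by ring

theorem half_le_log {x : ℝ} (hx : 2 ≤ x) : 1 / 2 ≤ log x := by
  linarith [log_two_gt_d9, log_le_log two_pos hx]

theorem three_mul_log_le_log {x T : ℝ} (hx : 0 < x) (hT : 0 < T) (h : x ≤ T ^ (1 / 3 : ℝ)) :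
    3 * log x ≤ log T := by
  have := log_le_log hx h
  rw [log_rpow hT] at this
  linarith

theorem exists_pow_le_and_log_le_two_mul {x T : ℝ} (hx : 1 < x) (hxT : x ≤ T) :
    ∃ k : ℕ, 1 ≤ k ∧ x ^ k ≤ T ∧ k * log x ≤ log T ∧ log T ≤ 2 * (k * log x) := by
  have hlx : 0 < log x := log_pos hx
  have hT : 0 < T := by linarith
  have hone : 1 ≤ log T / log x := (one_le_div hlx).2 (log_le_log (by linarith) hxT)
  have hk : (1 : ℕ) ≤ ⌊log T / log x⌋₊ := Nat.le_floor (by exact_mod_cast hone)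
  have hmul : ⌊log T / log x⌋₊ * log x ≤ log T :=
    (le_div_iff₀ hlx).1 (Nat.floor_le (zero_le_one.trans hone))
  refine ⟨_, hk, ?_, hmul, ?_⟩
  · rwa [← log_le_log_iff (by positivity) hT, log_pow]
  · have hk' : (1 : ℝ) ≤ ⌊log T / log x⌋₊ := by exact_mod_cast hk
    have := (div_lt_iff₀ hlx).1 (Nat.lt_floor_add_one (log T / log x))
    nlinarith

theorem mul_mul_pow_le_rpow_one_sub {K T u a c : ℝ} {k : ℕ} (hK : 0 < K) (hT : 0 < T)
    (hu : 0 ≤ u) (hua : u ≤ exp (-a)) (h : log K + log T * c ≤ k * a) :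
    K * T * u ^ k ≤ T ^ (1 - c) :=
  calc K * T * u ^ k ≤ exp (log K) * exp (log T) * exp (-a) ^ k := by
        rw [exp_log hK, exp_log hT]; gcongr
    _ = exp (log K + log T + k * -a) := by rw [← exp_nat_mul, ← exp_add, ← exp_add]
    _ ≤ exp (log T * (1 - c)) := exp_le_exp.2 (by linarith)
    _ = T ^ (1 - c) := (rpow_def_of_pos hT _).symm

theorem exp_sub_one_le_two_mul {s : ℝ} (hs : 0 ≤ s) (hs' : s ≤ 1) : exp s - 1 ≤ 2 * s := by
  have := abs_exp_sub_one_le ((abs_of_nonneg hs).trans_le hs')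
  rw [abs_of_nonneg hs] at this
  exact (le_abs_self _).trans this

theorem mul_mul_log_div_le {a b y : ℝ} (ha : 1 / 2 ≤ a) (hab : a ≤ b) (hb : 7 ≤ log b)
    (hy : a * b * log b ^ 5 ≤ y) : a * b * (log y / y) ≤ 7 / log b ^ 4 := by
  have hb0 : 0 < b := by linarith
  set L := log b
  set y₀ := a * b * L ^ 5
  have hLb : L ≤ b := log_le_self hb0.le
  have hab4 : 1 / 4 ≤ a * b := by nlinarith
  have hy₀ : 3 ≤ y₀ := by
    have : (7 : ℝ) ^ 5 ≤ L ^ 5 := by gcongr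
    calc (3 : ℝ) ≤ 1 / 4 * 7 ^ 5 := by norm_num
      _ ≤ a * b * L ^ 5 := by gcongr
  have hlog : log y₀ ≤ 7 * L :=
    calc log y₀ ≤ log (b * b * b ^ 5) := log_le_log (by linarith) (by
          change a * b * L ^ 5 ≤ b * b * b ^ 5
          gcongr)
      _ = log (b ^ 7) := by ring_nf
      _ = 7 * L := by rw [log_pow]; norm_cast
  have hanti : log y / y ≤ log y₀ / y₀ :=
    log_div_self_antitoneOn (show exp 1 ≤ y₀ by linarith [exp_one_lt_d9])
      (show exp 1 ≤ y by linarith [exp_one_lt_d9]) hy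
  calc a * b * (log y / y) ≤ a * b * (7 * L / y₀) := by
        refine mul_le_mul_of_nonneg_left (hanti.trans ?_) (by linarith)
        gcongr
    _ = 7 / L ^ 4 := by
        have : a ≠ 0 := by positivity
        simp only [y₀]
        field_simp

theorem two_le_and_mul_mul_le {C a b y : ℝ} (hC : 1 ≤ C) (ha : 1 / 2 ≤ a) (hab : a ≤ b)
    (hb : 7 * C ≤ log b) (hy : a * b * log b ^ 5 ≤ y) : 2 ≤ y ∧ C * (a * b) ≤ y := by
  have hab4 : 1 / 4 ≤ a * b := by nlinarith
  have hL : 8 * C ≤ log b ^ 5 :=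
    calc 8 * C ≤ 7 * (7 * C) := by linarith
      _ ≤ log b * log b := mul_le_mul (by linarith) hb (by linarith) (by linarith)
      _ = log b ^ 2 := (sq _).symm
      _ ≤ log b ^ 5 := pow_le_pow_right₀ (by linarith) (by norm_num)
  have : 8 * C * (a * b) ≤ y := by
    refine le_trans ?_ hy
    rw [mul_comm]
    gcongr
  constructor <;> nlinarith

theorem exp_sub_one_le_div_log_pow {C a b q y : ℝ} (hC : 1 ≤ C) (ha : 1 / 2 ≤ a) (hab : a ≤ b)
    (hb : 7 * C ≤ log b) (hy : a * b * log b ^ 5 ≤ y) (hq : 0 ≤ q) (hqC : q ≤ C * (a * b)) :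
    exp (q * log y / y) - 1 ≤ 14 * C / log b ^ 4 := by
  obtain ⟨hy2, -⟩ := two_le_and_mul_mul_le hC ha hab hb hy
  have hly : 0 ≤ log y := log_nonneg (by linarith)
  have hlb : 0 < log b := by linarith
  have hle : q * log y / y ≤ 7 * C / log b ^ 4 :=
    calc q * log y / y = q * (log y / y) := mul_div_assoc _ _ _
      _ ≤ C * (a * b) * (log y / y) := by gcongr
      _ ≤ C * (7 / log b ^ 4) := by
          rw [mul_assoc]
          gcongr
          exact mul_mul_log_div_le ha hab (by linarith) hy
      _ = 7 * C / log b ^ 4 := by ring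
  have hone : 7 * C / log b ^ 4 ≤ 1 :=
    (div_le_one (by positivity)).2 (hb.trans (le_self_pow₀ (by linarith) (by norm_num)))
  calc exp (q * log y / y) - 1 ≤ 2 * (q * log y / y) :=
        exp_sub_one_le_two_mul (by positivity) (hle.trans hone)
    _ ≤ 2 * (7 * C / log b ^ 4) := by gcongr
    _ = 14 * C / log b ^ 4 := by ring

theorem exists_zetaSum_sub_friableSum_of_le_log_log :
    ∃ C L₁ : ℝ, 0 < C ∧ 2 ≤ L₁ ∧ ∀ T x y : ℝ, 1 ≤ T → L₁ ≤ log (log T) → 2 ≤ x →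
      x ≤ T ^ (1 / 3 : ℝ) → log x * log T * log (log T) ^ 5 ≤ y →
      volume {t : ℝ | t ∈ Set.Icc 1 T ∧ ¬ ‖zetaSum x t - friableSum x y t‖
          ≤ C * (friableCount x y / log (log T) ^ 2)} ≤
        ENNReal.ofReal (T ^ (1 - 1 / log x)) := by
  obtain ⟨K, C, hK, hC, hvol⟩ := exists_volume_zetaSum_sub_friableSum_le
  refine ⟨√(14 * C * (K * exp 2)), 7 * C, by positivity, by linarith,
    fun T x y hT hL hx hxT hy ↦ ?_⟩
  have hlx : 1 / 2 ≤ log x := half_le_log hx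
  have hlT : 3 * log x ≤ log T := three_mul_log_le_log (by linarith) (by linarith) hxT
  have hlxT : log x ≤ log T := by linarith
  obtain ⟨k, hk, hxk, hklx, hlTk⟩ := exists_pow_le_and_log_le_two_mul (x := x) (T := T)
    (by linarith) ((log_le_log_iff (by linarith) (by linarith)).1 hlxT)
  obtain ⟨hy2, hCy⟩ := two_le_and_mul_mul_le hC hlx hlxT hL hy
  have hk' : (1 : ℝ) ≤ k := by exact_mod_cast hk
  have hklx2 : C * k * log x ^ 2 ≤ C * (log x * log T) :=
    calc C * k * log x ^ 2 = C * (log x * (k * log x)) := by ring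
      _ ≤ C * (log x * log T) := by gcongr
  have hlx2 : C * log x ^ 2 ≤ y := by
    refine le_trans ?_ (hklx2.trans hCy)
    gcongr
    exact le_mul_of_one_le_right (by linarith) hk'
  have hexp := exp_sub_one_le_div_log_pow hC hlx hlxT hL hy (by positivity) hklx2
  have hexp0 : 0 ≤ exp (C * k * log x ^ 2 * log y / y) - 1 := by
    have : 0 ≤ log y := log_nonneg (by linarith)
    exact sub_nonneg.2 (one_le_exp (by positivity))
  set L := log (log T)
  have hL0 : 0 < L := by linarith
  have hΨ := friableCount_pos (show 1 ≤ x by linarith) y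
  -- The constant in front of `Ψ / L ^ 2` is chosen to make this ratio at most `exp (-2) / K`.
  have hratio : (exp (C * k * log x ^ 2 * log y / y) - 1) * friableCount x y ^ 2 /
      (√(14 * C * (K * exp 2)) * (friableCount x y / L ^ 2)) ^ 2 ≤ exp (-(2 + log K)) := by
    rw [mul_pow, sq_sqrt (by positivity), div_le_iff₀ (by positivity), exp_neg, exp_add,
      exp_log (by linarith)]
    calc _ ≤ 14 * C / L ^ 4 * friableCount x y ^ 2 := by gcongr
      _ = _ := by field_simp
  have hlTlx : log T * (1 / log x) ≤ k * 2 := by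
    rw [mul_one_div, div_le_iff₀ (by linarith)]
    linarith
  simp only [not_le]
  refine (hvol T x y _ k (by linarith) (by linarith) hy2 hlx2
    ((hklx2.trans hCy).trans (le_self_pow₀ (by linarith) two_ne_zero)) hxk (by positivity)).trans
    (ENNReal.ofReal_le_ofReal (mul_mul_pow_le_rpow_one_sub (by linarith) (by linarith)
      (by positivity) hratio ?_))
  nlinarith [log_nonneg hK]

theorem exists_zetaSum_sub_friableSum :
    ∃ C : ℝ, 0 < C ∧ ∀ T x y : ℝ, 1 ≤ T → 2 ≤ x → x ≤ T ^ (1 / 3 : ℝ) →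
      log x * log T * log (log T) ^ 5 ≤ y →
      volume {t : ℝ | t ∈ Set.Icc 1 T ∧ ¬ ‖zetaSum x t - friableSum x y t‖
          ≤ C * (friableCount x y / log (log T) ^ 2)} ≤
        ENNReal.ofReal (T ^ (1 - 1 / log x)) := by
  obtain ⟨C, L₁, hC, hL₁, hlarge⟩ := exists_zetaSum_sub_friableSum_of_le_log_log
  set T₁ := exp (exp L₁)
  refine ⟨C + 2 * T₁ * L₁ ^ 2, by positivity, fun T x y hT hx hxT hy ↦ ?_⟩
  have hlT : 3 * log x ≤ log T := three_mul_log_le_log (by linarith) (by linarith) hxT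
  have hL : 0 < log (log T) := log_pos (by linarith [half_le_log hx])
  have hΨ := one_le_friableCount (show 1 ≤ x by linarith) y
  rcases le_or_gt L₁ (log (log T)) with hL₁L | hLL₁
  · refine (measure_mono ?_).trans (hlarge T x y hT hL₁L hx hxT hy)
    refine fun t ht ↦ ⟨ht.1, fun hle ↦ ht.2 (hle.trans ?_)⟩
    gcongr
    exact le_add_of_nonneg_right (by positivity)
  · -- For bounded `T` the trivial bound `2 x` is at most the claimed one.
    have hxT₁ : x ≤ T₁ := by
      have hTT₁ : T < T₁ := (log_lt_iff_lt_exp (by linarith)).1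
        ((log_lt_iff_lt_exp (by linarith [half_le_log hx])).1 hLL₁)
      exact ((log_le_log_iff (by linarith) (by linarith)).1
        (by linarith [half_le_log hx])).trans hTT₁.le
    have hbound (t : ℝ) : ‖zetaSum x t - friableSum x y t‖ ≤
        (C + 2 * T₁ * L₁ ^ 2) * (friableCount x y / log (log T) ^ 2) :=
      calc ‖zetaSum x t - friableSum x y t‖ ≤ 2 * x :=
            norm_zetaSum_sub_friableSum_le (by linarith) y t
        _ ≤ 2 * T₁ := by gcongr
        _ = (2 * T₁ * L₁ ^ 2) * (1 / L₁ ^ 2) := by field_simp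
        _ ≤ (C + 2 * T₁ * L₁ ^ 2) * (friableCount x y / log (log T) ^ 2) := by
            gcongr
            exact le_add_of_nonneg_left hC.le
    simp only [hbound, not_true_eq_false, and_false, Set.ofPred_false, measure_empty, zero_le]

/-! ### Lower bounds for `Ψ(X, y)` with `X` a bounded power of `y` -/

theorem card_filter_dvd_primesIoc_le {v y : ℝ} (hv : 1 < v) {n r : ℕ} (hn : n ≠ 0)
    (hnr : (n : ℝ) ≤ v ^ r) : #{p ∈ primesIoc v y | p ∣ n} ≤ r := by
  have hv0 : 0 < v := by linarith
  set P := {p ∈ primesIoc v y | p ∣ n}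
  have hP : ∀ p ∈ P, (p.Prime ∧ p ∣ n) ∧ v < p := fun p hp ↦ by
    simp only [P, primesIoc, mem_filter, mem_Ioc, Nat.floor_lt hv0.le] at hp
    tauto
  have hlog : #P * log v ≤ r * log v :=
    calc #P * log v = #P • log v := (nsmul_eq_mul _ _).symm
      _ ≤ ∑ p ∈ P, log p :=
          card_nsmul_le_sum _ _ _ fun p hp ↦ log_le_log hv0 (hP p hp).2.le
      _ ≤ log n := sum_log_prime_dvd_le_log hn fun p hp ↦ (hP p hp).1
      _ ≤ log (v ^ r) := log_le_log (by positivity) hnr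
      _ = r * log v := log_pow v r
  exact_mod_cast le_of_mul_le_mul_right hlog (log_pos hv)

theorem sum_friableCount_div_primesIoc_le {X v y : ℝ} (hv : 1 < v) (hy : 0 ≤ y) {r : ℕ}
    (hX : X ≤ v ^ r) :
    ∑ p ∈ primesIoc v y, friableCount (X / p) y ≤ r * friableCount X y := by
  have hfriable : ∀ p ∈ primesIoc v y, IsFriable y p := fun p hp ↦ by
    rw [mem_primesIoc (by linarith) hy] at hp
    exact isFriable_of_le hp.1.ne_zero hp.2.2
  have hswap := sum_friableUpTo_sum_dvd (x := X) _ hfriable fun _ ↦ 1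
  simp only [one_mul, sum_const, nsmul_eq_mul, mul_one] at hswap
  rw [← hswap, mul_comm, friableCount, ← nsmul_eq_mul]
  refine sum_le_card_nsmul _ _ _ fun n hn ↦ ?_
  rw [mem_friableUpTo] at hn
  exact_mod_cast card_filter_dvd_primesIoc_le hv hn.2.1 (hn.1.trans hX)

theorem exists_le_sum_inv_primesIoc_sqrt : ∃ c y₁ : ℝ, 0 < c ∧ 4 ≤ y₁ ∧
    ∀ y, y₁ ≤ y → c ≤ ∑ p ∈ primesIoc √y y, (1 : ℝ) / p := by
  obtain ⟨K, hK, c, hc, hsum⟩ := exists_mul_log_div_log_le_sum_inv_primesIoc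
  refine ⟨c / 2, max 4 (K ^ 2), half_pos hc, le_max_left _ _, fun y hy ↦ ?_⟩
  have hy4 : 4 ≤ y := (le_max_left _ _).trans hy
  have hKy : K ≤ √y := le_sqrt_of_sq_le ((le_max_right _ _).trans hy)
  have hmul : √y * √y = y := mul_self_sqrt (by linarith)
  have hly : 0 < log y := log_pos (by linarith)
  calc c / 2 = c * log (y / √y) / log y := by
        rw [div_sqrt, log_sqrt (by linarith)]
        field_simp
    _ ≤ ∑ p ∈ primesIoc √y y, (1 : ℝ) / p :=
        hsum √y y (by linarith) ((mul_le_mul_of_nonneg_right hKy (sqrt_nonneg y)).trans_eq hmul)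

theorem mul_le_friableCount_of_forall_le {X y δ a : ℝ} {r : ℕ} (hy : 4 ≤ y) (ha : 0 ≤ a)
    (hδ : δ ≤ ∑ p ∈ primesIoc √y y, (1 : ℝ) / p) (hX : √y ^ (r + 2) ≤ X) (hX' : X ≤ √y ^ (r + 3))
    (ih : ∀ X', 1 ≤ X' → X' ≤ √y ^ (r + 2) → a * X' ≤ friableCount X' y) :
    a * δ / (r + 3) * X ≤ friableCount X y := by
  set v := √y
  have hv2 : v ^ 2 = y := sq_sqrt (by linarith)
  have hv : 1 < v := lt_sqrt_of_sq_lt (by linarith)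
  have hX0 : 0 ≤ X := le_trans (by positivity) hX
  have hlower : a * X * δ ≤ ∑ p ∈ primesIoc v y, friableCount (X / p) y :=
    calc a * X * δ ≤ a * X * ∑ p ∈ primesIoc v y, (1 : ℝ) / p := by gcongr
      _ = ∑ p ∈ primesIoc v y, a * (X / p) := by
          rw [mul_sum]
          exact sum_congr rfl fun p _ ↦ by ring
      _ ≤ ∑ p ∈ primesIoc v y, friableCount (X / p) y := by
          refine sum_le_sum fun p hp ↦ ?_
          rw [mem_primesIoc (by linarith) (by linarith)] at hp
          have hp0 : (0 : ℝ) < p := by linarith [hp.2.1]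
          refine ih _ ((one_le_div hp0).2 ?_) ((div_le_iff₀ hp0).2 ?_)
          · calc (p : ℝ) ≤ v ^ 2 := hp.2.2.trans_eq hv2.symm
              _ ≤ v ^ (r + 2) := pow_le_pow_right₀ hv.le (by lia)
              _ ≤ X := hX
          · calc X ≤ v ^ (r + 2) * v := by rwa [← pow_succ]
              _ ≤ v ^ (r + 2) * p := by gcongr; exact hp.2.1.le
  have hupper := sum_friableCount_div_primesIoc_le hv (show 0 ≤ y by linarith) hX'
  push_cast at hupper
  rw [div_mul_eq_mul_div, div_le_iff₀ (by positivity)]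
  linarith

theorem exists_mul_le_friableCount_of_le_pow (r : ℕ) : ∃ c y₁ : ℝ, 0 < c ∧ 4 ≤ y₁ ∧
    ∀ X y : ℝ, y₁ ≤ y → 1 ≤ X → X ≤ √y ^ (r + 2) → c * X ≤ friableCount X y := by
  obtain ⟨δ, y₁, hδ, hy₁, hsum⟩ := exists_le_sum_inv_primesIoc_sqrt
  suffices h : ∃ a : ℝ, 0 < a ∧ ∀ X y : ℝ, y₁ ≤ y → 1 ≤ X → X ≤ √y ^ (r + 2) →
      a * X ≤ friableCount X y by
    obtain ⟨a, ha, h⟩ := h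
    exact ⟨a, y₁, ha, hy₁, h⟩
  induction r with
  | zero =>
    refine ⟨1 / 2, by norm_num, fun X y hy hX hXy ↦ ?_⟩
    rw [zero_add, sq_sqrt (by linarith)] at hXy
    rw [friableCount_eq_floor hXy]
    have : (1 : ℝ) ≤ ⌊X⌋₊ := mod_cast Nat.le_floor (by simpa using hX)
    linarith [Nat.lt_floor_add_one X]
  | succ r ih =>
    obtain ⟨a, ha, ih⟩ := ih
    refine ⟨min a (a * δ / (r + 3)), by positivity, fun X y hy hX hXy ↦ ?_⟩
    rcases le_total X (√y ^ (r + 2)) with hle | hle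
    · calc min a (a * δ / (r + 3)) * X ≤ a * X := by gcongr; exact min_le_left _ _
        _ ≤ friableCount X y := ih X y hy hX hle
    · calc min a (a * δ / (r + 3)) * X ≤ a * δ / (r + 3) * X := by gcongr; exact min_le_right _ _
        _ ≤ friableCount X y := mul_le_friableCount_of_forall_le (by linarith) ha.le (hsum y hy) hle
            hXy fun X' ↦ ih X' y hy

/-! ### Growth of the friable Chebyshev function -/

theorem friablePsi_mono {V V' y : ℝ} (h : V ≤ V') : friablePsi V y ≤ friablePsi V' y :=
  sum_le_sum_of_subset_of_nonneg (friableUpTo_mono h le_rfl)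
    fun _ _ _ ↦ ArithmeticFunction.vonMangoldt_nonneg

theorem friablePsi_le_six_mul {V : ℝ} (hV : 0 ≤ V) (y : ℝ) : friablePsi V y ≤ 6 * V :=
  calc friablePsi V y ≤ ψ V := by
        refine sum_le_sum_of_subset_of_nonneg (fun n hn ↦ ?_)
          fun _ _ _ ↦ ArithmeticFunction.vonMangoldt_nonneg
        rw [mem_friableUpTo] at hn
        exact mem_Ioc.2 ⟨Nat.pos_of_ne_zero hn.2.1, Nat.le_floor hn.1⟩
    _ ≤ (log 4 + 4) * V := Chebyshev.psi_le_const_mul_self hV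
    _ ≤ 6 * V := by
        gcongr
        linarith [log_four, log_two_lt_d9]

theorem theta_eq_sum_primesIoc {y : ℝ} (hy : 0 ≤ y) : θ y = ∑ p ∈ primesIoc 0 y, log p := by
  rw [← theta_sub_theta hy, Chebyshev.theta_zero, sub_zero]

theorem theta_le_friablePsi {V y z : ℝ} (hz : 0 ≤ z) (hzV : z ≤ V) (hzy : z ≤ y) :
    θ z ≤ friablePsi V y :=
  calc θ z = ∑ p ∈ primesIoc 0 z, Λ p := by
        rw [theta_eq_sum_primesIoc hz]
        refine sum_congr rfl fun p hp ↦ ?_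
        rw [ArithmeticFunction.vonMangoldt_apply_prime ((mem_primesIoc le_rfl hz).1 hp).1]
    _ ≤ friablePsi V y := by
        refine sum_le_sum_of_subset_of_nonneg (fun p hp ↦ ?_)
          fun _ _ _ ↦ ArithmeticFunction.vonMangoldt_nonneg
        rw [mem_primesIoc le_rfl hz] at hp
        exact mem_friableUpTo.2
          ⟨hp.2.2.trans hzV, isFriable_of_le hp.1.ne_zero (hp.2.2.trans hzy)⟩

theorem injOn_minFac_isPrimePow (V : ℝ) :
    Set.InjOn Nat.minFac {d : ℕ | IsPrimePow d ∧ V < d ∧ (d : ℝ) ≤ 2 * V} := by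
  rintro d ⟨hd, hVd, hdV⟩ e ⟨he, hVe, heV⟩ hde
  have hq : (2 : ℝ) ≤ d.minFac := mod_cast (Nat.minFac_prime hd.ne_one).two_le
  have hle {i j : ℕ} (hi : V < (d.minFac : ℝ) ^ i) (hj : (d.minFac : ℝ) ^ j ≤ 2 * V) : j ≤ i := by
    by_contra! hij
    have : (d.minFac : ℝ) ^ i * d.minFac ≤ d.minFac ^ j := by
      rw [← pow_succ]
      exact pow_le_pow_right₀ (by linarith) hij
    nlinarith
  have hd' := hd.minFac_pow_factorization_eq
  have he' := he.minFac_pow_factorization_eq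
  rw [← hde] at he'
  rw [← hd', Nat.cast_pow] at hVd hdV
  rw [← he', Nat.cast_pow] at hVe heV
  rw [← hd', ← he', le_antisymm (hle hVd heV) (hle hVe hdV)]

theorem friablePsi_two_mul_le {V y : ℝ} (hV : 0 ≤ V) (hy : 0 ≤ y) :
    friablePsi (2 * V) y ≤ friablePsi V y + θ y := by
  classical
  have hsub : friableUpTo V y ⊆ friableUpTo (2 * V) y := friableUpTo_mono (by linarith) le_rfl
  rw [friablePsi, friablePsi, ← sum_sdiff hsub, add_comm]
  gcongr
  set D := {d ∈ friableUpTo (2 * V) y \ friableUpTo V y | IsPrimePow d}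
  have hD : ∀ d ∈ D, (IsPrimePow d ∧ V < d ∧ (d : ℝ) ≤ 2 * V) ∧ IsFriable y d := fun d hd ↦ by
    rw [mem_filter, Finset.mem_sdiff, mem_friableUpTo, mem_friableUpTo] at hd
    obtain ⟨⟨⟨hd2V, hfriable⟩, hdV⟩, hpow⟩ := hd
    exact ⟨⟨hpow, not_le.1 fun hle ↦ hdV ⟨hle, hfriable⟩, hd2V⟩, hfriable⟩
  calc ∑ d ∈ friableUpTo (2 * V) y \ friableUpTo V y, Λ d = ∑ d ∈ D, log d.minFac := by
        simp only [D, sum_filter, ArithmeticFunction.vonMangoldt_apply]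
    _ = ∑ q ∈ D.image Nat.minFac, log q := by
        rw [sum_image ((injOn_minFac_isPrimePow V).mono fun d hd ↦ (hD d hd).1)]
    _ ≤ ∑ p ∈ primesIoc 0 y, log p := by
        refine sum_le_sum_of_subset_of_nonneg (fun q hq ↦ ?_) fun q _ _ ↦ log_natCast_nonneg q
        obtain ⟨d, hd, rfl⟩ := mem_image.1 hq
        obtain ⟨⟨hpow, -⟩, hfriable⟩ := hD d hd
        have hprime := Nat.minFac_prime hpow.ne_one
        exact (mem_primesIoc le_rfl hy).2
          ⟨hprime, mod_cast hprime.pos, hfriable.2 _ hprime d.minFac_dvd⟩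
    _ = θ y := (theta_eq_sum_primesIoc hy).symm

theorem friablePsi_two_pow_mul_le_add {V y : ℝ} (hV : 0 ≤ V) (hy : 0 ≤ y) (i : ℕ) :
    friablePsi (2 ^ i * V) y ≤ friablePsi V y + i * θ y := by
  induction i with
  | zero => simp
  | succ i ih =>
    have := friablePsi_two_mul_le (V := 2 ^ i * V) (by positivity) hy
    rw [pow_succ', mul_assoc]
    push_cast
    linarith

theorem friablePsi_two_pow_mul_le_mul {V y : ℝ} (hy : 0 ≤ y) (hV : y ≤ V) (i : ℕ) :
    friablePsi (2 ^ i * V) y ≤ 2 ^ i * friablePsi V y := by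
  induction i with
  | zero => simp
  | succ i ih =>
    have hle : V ≤ 2 ^ i * V := le_mul_of_one_le_left (by linarith) (one_le_pow₀ one_le_two)
    have hdouble := friablePsi_two_mul_le (V := 2 ^ i * V) (by linarith) hy
    have hθ := theta_le_friablePsi hy (hV.trans hle) le_rfl
    rw [pow_succ', mul_assoc, mul_assoc]
    linarith

theorem exists_friablePsi_mul_le : ∃ C : ℝ, 1 ≤ C ∧ ∀ V y w : ℝ, 1 ≤ V → 0 ≤ y → 1 ≤ w →
    friablePsi (w * V) y ≤ C * w * (friablePsi V y + 1) := by
  obtain ⟨c, hc, hc1, hθ⟩ := exists_mul_le_theta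
  have h12 : 12 ≤ 12 / c := by rw [le_div_iff₀ hc]; linarith
  refine ⟨12 / c, by linarith, fun V y w hV hy hw ↦ ?_⟩
  have hψ := friablePsi_nonneg V y
  rcases le_or_gt y V with hyV | hVy
  · obtain ⟨i, hi, hi'⟩ := exists_nat_pow_near hw (one_lt_two (α := ℝ))
    calc friablePsi (w * V) y ≤ friablePsi (2 ^ (i + 1) * V) y := friablePsi_mono (by gcongr)
      _ ≤ 2 ^ (i + 1) * friablePsi V y := friablePsi_two_pow_mul_le_mul hy hyV _
      _ ≤ 12 / c * w * (friablePsi V y + 1) := by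
          refine mul_le_mul ?_ (by linarith) hψ (by positivity)
          rw [pow_succ]
          nlinarith
  · have hlinear : friablePsi (w * V) y ≤ 6 * (w * V) := friablePsi_le_six_mul (by positivity) y
    refine hlinear.trans ?_
    rcases le_or_gt 2 V with hV2 | hV2
    · calc 6 * (w * V) = 6 / c * w * (c * V) := by field_simp
        _ ≤ 12 / c * w * (friablePsi V y + 1) := by
            gcongr
            · norm_num
            · linarith [hθ V hV2, theta_le_friablePsi (show 0 ≤ V by linarith) le_rfl hVy.le]
    · calc 6 * (w * V) ≤ 12 * w * 1 := by nlinarith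
        _ ≤ 12 / c * w * (friablePsi V y + 1) := by
            gcongr
            linarith

/-! ### Lower bounds for `Ψ(x / y, y)` in terms of `Ψ(x, y)` -/

theorem div_le_sum_range_two_pow {X Z m : ℝ} {I : ℕ} (hX : 0 < X) (hXm : X < m) (hmZ : m ≤ Z)
    (hI : Z ≤ 2 ^ I * X) :
    Z / m ≤ ∑ i ∈ range I, if m ≤ Z / 2 ^ i then (2 : ℝ) ^ (i + 1) else 0 := by
  have hm : 0 < m := hX.trans hXm
  obtain ⟨i, hle, hlt⟩ := exists_nat_pow_near ((one_le_div hm).2 hmZ) (one_lt_two (α := ℝ))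
  rw [le_div_iff₀ hm] at hle
  have hiI : i < I := by
    refine (pow_lt_pow_iff_right₀ (one_lt_two (α := ℝ))).1 (lt_of_mul_lt_mul_right ?_ hm.le)
    calc 2 ^ i * m ≤ 2 ^ I * X := hle.trans hI
      _ < 2 ^ I * m := by gcongr
  calc Z / m ≤ if m ≤ Z / 2 ^ i then (2 : ℝ) ^ (i + 1) else 0 := by
        rw [if_pos ((le_div_iff₀' (by positivity)).2 hle)]
        exact hlt.le
    _ ≤ _ := single_le_sum (f := fun i ↦ if m ≤ Z / 2 ^ i then (2 : ℝ) ^ (i + 1) else 0)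
        (fun _ _ ↦ by positivity) (mem_range.2 hiI)

theorem sum_div_friableUpTo_le {X w y M : ℝ} {I : ℕ} (hX : 0 < X) (hw : 1 ≤ w) (hI : w ≤ 2 ^ I)
    (hM : ∀ u, 1 ≤ u → u ≤ w → friableCount (u * X) y ≤ M * u) :
    ∑ m ∈ friableUpTo (w * X) y \ friableUpTo X y, w * X / m ≤ 2 * I * (M * w) := by
  set F := friableUpTo (w * X) y \ friableUpTo X y
  have hF : ∀ m ∈ F, (X < m ∧ m ≤ w * X) ∧ IsFriable y m := fun m hm ↦ by
    rw [Finset.mem_sdiff, mem_friableUpTo, mem_friableUpTo] at hm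
    exact ⟨⟨not_le.1 fun hmX ↦ hm.2 ⟨hmX, hm.1.2⟩, hm.1.1⟩, hm.1.2⟩
  have hM0 : 0 ≤ M := by
    have := hM 1 le_rfl hw
    linarith [friableCount_nonneg (1 * X) y]
  calc ∑ m ∈ F, w * X / m
      ≤ ∑ m ∈ F, ∑ i ∈ range I, if (m : ℝ) ≤ w * X / 2 ^ i then (2 : ℝ) ^ (i + 1) else 0 := by
        refine sum_le_sum fun m hm ↦ ?_
        exact div_le_sum_range_two_pow hX (hF m hm).1.1 (hF m hm).1.2 (by gcongr)
    _ = ∑ i ∈ range I, #(F.filter fun m : ℕ ↦ (m : ℝ) ≤ w * X / 2 ^ i) * (2 : ℝ) ^ (i + 1) := by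
        rw [sum_comm]
        exact sum_congr rfl fun i _ ↦ by rw [← sum_filter, sum_const, nsmul_eq_mul]
    _ ≤ ∑ i ∈ range I, 2 * (M * w) := by
        refine sum_le_sum fun i _ ↦ ?_
        rcases le_or_gt X (w * X / 2 ^ i) with hXi | hXi
        · have hu : 1 ≤ w / 2 ^ i := by
            rw [mul_div_right_comm] at hXi
            exact le_of_mul_le_mul_right (by rwa [one_mul]) hX
          have huw : w / 2 ^ i ≤ w := div_le_self (by linarith) (one_le_pow₀ one_le_two)
          calc #(F.filter fun m : ℕ ↦ (m : ℝ) ≤ w * X / 2 ^ i) * (2 : ℝ) ^ (i + 1)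
              ≤ friableCount (w / 2 ^ i * X) y * 2 ^ (i + 1) := by
                rw [← mul_div_right_comm, friableCount]
                gcongr
                intro m hm
                rw [mem_filter] at hm
                exact mem_friableUpTo.2 ⟨hm.2, (hF m hm.1).2⟩
            _ ≤ M * (w / 2 ^ i) * 2 ^ (i + 1) := by gcongr; exact hM _ hu huw
            _ = 2 * (M * w) := by field_simp; ring
        · have hempty : F.filter (fun m : ℕ ↦ (m : ℝ) ≤ w * X / 2 ^ i) = ∅ :=
            filter_false_of_mem fun m hm ↦ (hXi.trans (hF m hm).1.1).not_ge
          rw [hempty, card_empty, Nat.cast_zero, zero_mul]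
          positivity
    _ = 2 * I * (M * w) := by
        rw [sum_const, card_range, nsmul_eq_mul]
        ring

theorem exists_le_two_pow {y : ℝ} (hy : 2 ≤ y) : ∃ I : ℕ, y ≤ 2 ^ I ∧ I ≤ 3 * log y := by
  obtain ⟨n, hle, hlt⟩ := exists_nat_pow_near (one_le_two.trans hy) (one_lt_two (α := ℝ))
  refine ⟨n + 1, hlt.le, ?_⟩
  have hn : n * log 2 ≤ log y := by
    rw [← log_pow]
    exact log_le_log (by positivity) hle
  have : (n : ℝ) * 0.69 ≤ n * log 2 := by gcongr; linarith [log_two_gt_d9]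
  push_cast
  linarith [log_le_log two_pos hy, log_two_gt_d9]

theorem sum_log_friableUpTo_le_add {X w : ℝ} (y : ℝ) (hX : 0 < X) (hw : 1 ≤ w) :
    ∑ n ∈ friableUpTo (w * X) y, log n ≤ ∑ m ∈ friableUpTo X y, friablePsi (w * (X / m)) y +
      6 * ∑ m ∈ friableUpTo (w * X) y \ friableUpTo X y, w * X / m := by
  have hsub : friableUpTo X y ⊆ friableUpTo (w * X) y :=
    friableUpTo_mono (le_mul_of_one_le_left hX.le hw) le_rfl
  rw [sum_log_friableUpTo, ← sum_sdiff hsub, add_comm, mul_sum]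
  gcongr with m _ m _
  · rw [mul_div_assoc]
  · exact friablePsi_le_six_mul (by positivity) _

theorem sum_log_friableUpTo_le_of_forall_le {X w y M : ℝ} (hX : 0 < X) (hw : 1 ≤ w) (hwy : w ≤ y)
    (hy : 2 ≤ y) (hM : ∀ u, 1 ≤ u → u ≤ w → friableCount (u * X) y ≤ M * u) :
    ∑ n ∈ friableUpTo (w * X) y, log n ≤
      ∑ m ∈ friableUpTo X y, friablePsi (w * (X / m)) y + 36 * log y * (M * w) := by
  obtain ⟨I, hyI, hI⟩ := exists_le_two_pow hy
  have hM0 : 0 ≤ M := by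
    have := hM 1 le_rfl hw
    linarith [friableCount_nonneg (1 * X) y]
  calc ∑ n ∈ friableUpTo (w * X) y, log n
      ≤ ∑ m ∈ friableUpTo X y, friablePsi (w * (X / m)) y +
          6 * ∑ m ∈ friableUpTo (w * X) y \ friableUpTo X y, w * X / m :=
        sum_log_friableUpTo_le_add y hX hw
    _ ≤ ∑ m ∈ friableUpTo X y, friablePsi (w * (X / m)) y + 6 * (2 * (3 * log y) * (M * w)) := by
        gcongr
        refine (sum_div_friableUpTo_le hX hw (hwy.trans hyI) hM).trans ?_
        gcongr
    _ = _ := by ring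

theorem sub_mul_log_le_sum_log_friableUpTo {V X Z : ℝ} (y : ℝ) (hV : 0 < V) (hVX : V ≤ X)
    (hXZ : X ≤ Z) :
    (friableCount Z y - friableCount X y) * log V ≤ ∑ n ∈ friableUpTo Z y, log n := by
  have hsub : friableUpTo X y ⊆ friableUpTo Z y := friableUpTo_mono hXZ le_rfl
  calc (friableCount Z y - friableCount X y) * log V
      = #(friableUpTo Z y \ friableUpTo X y) • log V := by
        rw [card_sdiff_of_subset hsub, nsmul_eq_mul, Nat.cast_sub (card_le_card hsub)]
        rfl
    _ ≤ ∑ n ∈ friableUpTo Z y \ friableUpTo X y, log n := by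
        refine card_nsmul_le_sum _ _ _ fun n hn ↦ log_le_log hV ?_
        rw [Finset.mem_sdiff, mem_friableUpTo, mem_friableUpTo] at hn
        by_contra! hlt
        exact hn.2 ⟨hlt.le.trans hVX, hn.1.2⟩
    _ ≤ ∑ n ∈ friableUpTo Z y, log n :=
        sum_le_sum_of_subset_of_nonneg sdiff_subset fun n _ _ ↦ log_natCast_nonneg n

theorem exists_sum_friablePsi_mul_le : ∃ C : ℝ, 1 ≤ C ∧ ∀ X y w : ℝ, 0 ≤ y → 1 ≤ w →
    ∑ m ∈ friableUpTo X y, friablePsi (w * (X / m)) y ≤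
      C * w * ((log X + 1) * friableCount X y) := by
  obtain ⟨C, hC, hψ⟩ := exists_friablePsi_mul_le
  refine ⟨C, hC, fun X y w hy hw ↦ ?_⟩
  calc ∑ m ∈ friableUpTo X y, friablePsi (w * (X / m)) y
      ≤ ∑ m ∈ friableUpTo X y, C * w * (friablePsi (X / m) y + 1) := by
        refine sum_le_sum fun m hm ↦ hψ _ _ _ ?_ hy hw
        rw [mem_friableUpTo] at hm
        exact (one_le_div (mod_cast hm.2.pos)).2 hm.1
    _ = C * w * (∑ n ∈ friableUpTo X y, log n + friableCount X y) := by
        rw [← mul_sum, sum_add_distrib, ← sum_log_friableUpTo, sum_const, nsmul_one, friableCount]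
    _ ≤ C * w * (friableCount X y * log X + friableCount X y) := by
        gcongr
        exact sum_log_friableUpTo_le X y
    _ = C * w * ((log X + 1) * friableCount X y) := by ring

theorem sum_friablePsi_mul_le {X y w : ℝ} {I : ℕ} (hX : 0 ≤ X) (hy : 0 ≤ y) (hw : w ≤ 2 ^ I) :
    ∑ m ∈ friableUpTo X y, friablePsi (w * (X / m)) y ≤ friableCount X y * (log X + I * θ y) :=
  calc ∑ m ∈ friableUpTo X y, friablePsi (w * (X / m)) y
      ≤ ∑ m ∈ friableUpTo X y, (friablePsi (X / m) y + I * θ y) := by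
        refine sum_le_sum fun m _ ↦ ?_
        have hXm : 0 ≤ X / m := div_nonneg hX (Nat.cast_nonneg m)
        exact (friablePsi_mono (by gcongr)).trans (friablePsi_two_pow_mul_le_add hXm hy I)
    _ = ∑ n ∈ friableUpTo X y, log n + friableCount X y * (I * θ y) := by
        rw [sum_add_distrib, ← sum_log_friableUpTo, sum_const, nsmul_eq_mul, friableCount]
    _ ≤ friableCount X y * log X + friableCount X y * (I * θ y) := by
        gcongr
        exact sum_log_friableUpTo_le X y
    _ = friableCount X y * (log X + I * θ y) := by ring

theorem exists_friableCount_mul_le_and_mul_le_two_mul {X y : ℝ} (hX : 1 ≤ X) (hy : 1 ≤ y) :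
    ∃ M w : ℝ, 1 ≤ w ∧ w ≤ y ∧ (∀ u, 1 ≤ u → u ≤ y → friableCount (u * X) y ≤ M * u) ∧
      M * w ≤ 2 * friableCount (w * X) y := by
  set S := (fun u ↦ friableCount (u * X) y / u) '' Set.Icc 1 y
  have hbdd : BddAbove S := by
    refine ⟨X, ?_⟩
    rintro _ ⟨u, ⟨hu, -⟩, rfl⟩
    refine (div_le_iff₀ (by linarith)).2 ?_
    rw [mul_comm X]
    exact friableCount_le_self (by positivity) y
  have hle : ∀ u, 1 ≤ u → u ≤ y → friableCount (u * X) y ≤ sSup S * u := fun u hu huy ↦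
    (div_le_iff₀ (by linarith)).1 (le_csSup hbdd ⟨u, ⟨hu, huy⟩, rfl⟩)
  have hS : 0 < sSup S := by
    have := hle 1 le_rfl hy
    rw [one_mul, mul_one] at this
    linarith [one_le_friableCount hX y]
  obtain ⟨_, ⟨w, ⟨hw, hwy⟩, rfl⟩, hlt⟩ :=
    exists_lt_of_lt_csSup ((Set.nonempty_Icc.2 hy).image _) (half_lt_self hS)
  rw [lt_div_iff₀ (by linarith)] at hlt
  exact ⟨sSup S, w, hw, hwy, hle, by linarith⟩

theorem exists_friableCount_mul_le : ∃ K : ℝ, 1 ≤ K ∧ ∀ X y w : ℝ, 2 ≤ y → 1 ≤ X →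
    144 * log y ≤ log X → 1 ≤ w → w ≤ y → friableCount (w * X) y ≤ K * w * friableCount X y := by
  obtain ⟨C, hC, hψ⟩ := exists_sum_friablePsi_mul_le
  refine ⟨4 * (1 + 2 * C), by linarith, fun X y u hy hX hXy hu huy ↦ ?_⟩
  obtain ⟨M, w, hw, hwy, hM, hMw⟩ :=
    exists_friableCount_mul_le_and_mul_le_two_mul hX (show 1 ≤ y by linarith)
  have hly := half_le_log hy
  have hΨ := friableCount_nonneg X y
  have hM0 : 0 ≤ M := by
    have := hM 1 le_rfl (by linarith)
    linarith [friableCount_nonneg (1 * X) y]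
  have hlower := sub_mul_log_le_sum_log_friableUpTo y (by linarith) le_rfl
    (le_mul_of_one_le_left (show 0 ≤ X by linarith) hw)
  have hupper := sum_log_friableUpTo_le_of_forall_le (by linarith) hw hwy hy
    fun u hu huw ↦ hM u hu (huw.trans hwy)
  have hfirst := hψ X y w (by linarith) hw
  have hself : log X * (M * w) ≤ log X * (4 * (1 + 2 * C) * w * friableCount X y) := by
    have hsecond : 36 * log y * (M * w) ≤ log X / 4 * (M * w) := by gcongr; linarith
    have hmain : C * w * ((log X + 1) * friableCount X y) ≤
        C * w * (2 * log X * friableCount X y) := by gcongr; linarith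
    have hmax : log X * (M * w) ≤ log X * (2 * friableCount (w * X) y) := by gcongr; linarith
    have hone : log X * friableCount X y ≤ w * (log X * friableCount X y) :=
      le_mul_of_one_le_left (mul_nonneg (by linarith) hΨ) hw
    linarith
  have hbound : M ≤ 4 * (1 + 2 * C) * friableCount X y := by
    refine le_of_mul_le_mul_right ?_ (show 0 < w by linarith)
    linarith [le_of_mul_le_mul_left hself (by linarith)]
  calc friableCount (u * X) y ≤ M * u := hM u hu huy
    _ ≤ 4 * (1 + 2 * C) * friableCount X y * u := by gcongr
    _ = 4 * (1 + 2 * C) * u * friableCount X y := by ring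

theorem log_div_mul_friableCount_le {c x y : ℝ} (hc : 0 ≤ c) (hy : 2 ≤ y) (hyx : y ≤ x)
    (hxy : log x ≤ 145 * log y) (h : c * (x / y) ≤ friableCount (x / y) y) :
    c / 145 * (log x / (y * log y)) * friableCount x y ≤ friableCount (x / y) y := by
  have : 0 ≤ log x := log_nonneg (by linarith)
  have hly : 0 < log y := log_pos (by linarith)
  have hΨ := friableCount_nonneg x y
  calc c / 145 * (log x / (y * log y)) * friableCount x y
      ≤ c / 145 * (145 * log y / (y * log y)) * x := by
        gcongr
        exact friableCount_le_self (by linarith) y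
    _ = c * (x / y) := by field_simp
    _ ≤ friableCount (x / y) y := h

theorem sum_log_friableUpTo_le_mul {K x y : ℝ} (hy : 2 ≤ y) (hyx : y ≤ x) (hxy : log x ≤ y)
    (hK : ∀ u, 1 ≤ u → u ≤ y →
      friableCount (u * (x / y)) y ≤ K * u * friableCount (x / y) y) :
    ∑ n ∈ friableUpTo x y, log n ≤ (8 + 36 * K) * (y * log y) * friableCount (x / y) y := by
  obtain ⟨I, hyI, hI⟩ := exists_le_two_pow hy
  have hX : 0 < x / y := div_pos (by linarith) (by linarith)
  have hlX : log (x / y) ≤ log x := log_le_log hX (div_le_self (by linarith) (by linarith))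
  have hly := half_le_log hy
  have hθ : θ y ≤ 2 * y := by
    refine (Chebyshev.theta_le_log4_mul_x (by linarith)).trans ?_
    gcongr
    linarith [log_four, log_two_lt_d9]
  have hfirst : ∑ m ∈ friableUpTo (x / y) y, friablePsi (y * (x / y / m)) y ≤
      friableCount (x / y) y * (8 * (y * log y)) := by
    refine (sum_friablePsi_mul_le hX.le (by linarith) hyI).trans ?_
    refine mul_le_mul_of_nonneg_left ?_ (friableCount_nonneg _ _)
    calc log (x / y) + I * θ y ≤ 2 * log y * y + 3 * log y * (2 * y) := by
          gcongr
          nlinarith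
      _ = 8 * (y * log y) := by ring
  have hsplit := sum_log_friableUpTo_le_of_forall_le (M := K * friableCount (x / y) y) hX
    (show 1 ≤ y by linarith) le_rfl hy fun u hu huy ↦ (hK u hu huy).trans_eq (by ring)
  rw [mul_div_cancel₀ x (by linarith)] at hsplit
  linarith

theorem log_div_four_mul_friableCount_le {x y : ℝ} (hy : 1 ≤ y) (hyx : y ^ 2 ≤ x)
    (hhalf : friableCount (x / y) y ≤ 1 / 2 * friableCount x y) :
    log x / 4 * friableCount x y ≤ ∑ n ∈ friableUpTo x y, log n := by
  have hx : 1 ≤ x := (one_le_pow₀ hy).trans hyx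
  have hsqrt : √x ≤ x / y := by
    rw [le_div_iff₀ (by linarith)]
    calc √x * y ≤ √x * √x := by gcongr; exact le_sqrt_of_sq_le hyx
      _ = x := mul_self_sqrt (by linarith)
  calc log x / 4 * friableCount x y
      ≤ (friableCount x y - friableCount (x / y) y) * log √x := by
        rw [log_sqrt (by linarith)]
        nlinarith [log_nonneg hx]
    _ ≤ ∑ n ∈ friableUpTo x y, log n :=
        sub_mul_log_le_sum_log_friableUpTo y (sqrt_pos.2 (by linarith)) hsqrt
          (div_le_self (by linarith) hy)

theorem exists_mul_friableCount_le_friableCount_div_self_of_log_le : ∃ c y₁ : ℝ, 0 < c ∧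
    ∀ x y : ℝ, 4 ≤ y → y₁ ≤ y → y ≤ x → log x ≤ 145 * log y →
      c * (log x / (y * log y)) * friableCount x y ≤ friableCount (x / y) y := by
  obtain ⟨c, y₁, hc, -, hbounded⟩ := exists_mul_le_friableCount_of_le_pow 290
  refine ⟨c / 145, y₁, by positivity, fun x y hy hy₁ hyx hxy ↦ ?_⟩
  have hly : 0 ≤ log y := log_nonneg (by linarith)
  refine log_div_mul_friableCount_le hc.le (by linarith) hyx hxy
    (hbounded _ _ hy₁ ((one_le_div (by linarith)).2 hyx) ?_)
  refine (div_le_self (by linarith) (by linarith)).trans ?_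
  rw [← log_le_log_iff (by linarith) (by positivity), log_pow, log_sqrt (by linarith)]
  push_cast
  linarith

theorem exists_mul_friableCount_le_friableCount_div_self_of_lt_log : ∃ c C : ℝ, 0 < c ∧
    ∀ x y : ℝ, 0 < x → 4 ≤ y → C * log x ≤ y → 145 * log y < log x →
      c * (log x / (y * log y)) * friableCount x y ≤ friableCount (x / y) y := by
  obtain ⟨K, hK, hmul⟩ := exists_friableCount_mul_le
  obtain ⟨C, hC, hratio⟩ := exists_friableRatio_le_mul_log_div
  refine ⟨1 / (4 * (8 + 36 * K)), 2 * C, by positivity, fun x y hx hy hxy hyx ↦ ?_⟩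
  have hly := half_le_log (show 2 ≤ y by linarith)
  have hyx2 : y ^ 2 ≤ x := by
    rw [← log_le_log_iff (by positivity) hx, log_pow]
    push_cast
    linarith
  have hyx1 : y ≤ x := by nlinarith
  have hX : 1 ≤ x / y := (one_le_div (by linarith)).2 hyx1
  have hhalf : friableCount (x / y) y ≤ 1 / 2 * friableCount x y := by
    refine (friableCount_div_le (by linarith) le_rfl).trans
      (mul_le_mul_of_nonneg_right ?_ (friableCount_nonneg x y))
    refine (hratio x y y (by linarith) (by linarith) le_rfl).trans ?_
    rw [div_le_iff₀ (by linarith)]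
    linarith
  have hupper := sum_log_friableUpTo_le_mul (K := K) (by linarith) hyx1 (by nlinarith)
    fun u hu huy ↦ hmul _ _ _ (by linarith) hX
      (by rw [log_div (by linarith) (by linarith)]; linarith) hu huy
  have hlower := log_div_four_mul_friableCount_le (by linarith) hyx2 hhalf
  calc 1 / (4 * (8 + 36 * K)) * (log x / (y * log y)) * friableCount x y
      = log x / 4 * friableCount x y / ((8 + 36 * K) * (y * log y)) := by field_simp
    _ ≤ friableCount (x / y) y := by
        rw [div_le_iff₀ (by positivity)]
        linarith

theorem exists_mul_friableCount_le_friableCount_div_self : ∃ c C : ℝ, 0 < c ∧ c ≤ 1 ∧ 4 ≤ C ∧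
    ∀ x y : ℝ, C ≤ y → C * log x ≤ y → y ≤ x →
      c * (log x / (y * log y)) * friableCount x y ≤ friableCount (x / y) y := by
  obtain ⟨c₀, y₁, hc₀, hsmall⟩ := exists_mul_friableCount_le_friableCount_div_self_of_log_le
  obtain ⟨c₁, C₁, hc₁, hlarge⟩ := exists_mul_friableCount_le_friableCount_div_self_of_lt_log
  refine ⟨min 1 (min c₀ c₁), max 4 (max y₁ C₁), by positivity, min_le_left _ _, le_max_left _ _,
    fun x y hCy hxy hyx ↦ ?_⟩
  obtain ⟨hy4, hy₁⟩ : 4 ≤ y ∧ y₁ ≤ y := by simp_all only [sup_le_iff, and_self]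
  have hly : 0 ≤ log y := log_nonneg (by linarith)
  have hlx : 0 ≤ log x := log_nonneg (by linarith)
  have hΨ := friableCount_nonneg x y
  rcases le_or_gt (log x) (145 * log y) with h | h
  · refine le_trans ?_ (hsmall x y hy4 hy₁ hyx h)
    gcongr
    exact (min_le_right _ _).trans (min_le_left _ _)
  · have hC₁ : C₁ * log x ≤ y := by
      refine le_trans ?_ hxy
      gcongr
      exact (le_max_right _ _).trans (le_max_right _ _)
    refine le_trans ?_ (hlarge x y (by linarith) hy4 hC₁ h)
    gcongr
    exact (min_le_right _ _).trans (min_le_right _ _)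

/-! ### Exponential growth of `Ψ(x, ·)` -/

theorem friableCount_prime (x : ℝ) {p : ℕ} (hp : p.Prime) :
    friableCount x p = friableCount x (p - 1 : ℕ) + friableCount (x / p) p := by
  have hpred : {n ∈ friableUpTo x p | ¬ p ∣ n} = friableUpTo x (p - 1 : ℕ) := by
    ext n
    rw [mem_filter, mem_friableUpTo, mem_friableUpTo, and_assoc, and_congr_right_iff]
    refine fun _ ↦ ⟨fun ⟨hn, hpn⟩ ↦ ⟨hn.1, fun q hq hqn ↦ ?_⟩, fun hn ↦ ⟨?_, fun hpn ↦ ?_⟩⟩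
    · have hqp : q ≤ p := mod_cast hn.2 q hq hqn
      exact_mod_cast Nat.le_sub_one_of_lt (hqp.lt_of_ne fun h ↦ hpn (h ▸ hqn))
    · exact hn.mono (mod_cast Nat.sub_le p 1)
    · exact (Nat.sub_one_lt hp.ne_zero).not_ge (mod_cast hn.2 p hp hpn)
  rw [← card_filter_dvd_friableUpTo (isFriable_of_le hp.ne_zero le_rfl), friableCount, friableCount,
    ← hpred, ← card_filter_add_card_filter_not (s := friableUpTo x p) (p ∣ ·), Nat.cast_add,
    add_comm]

theorem friableCount_floor (x : ℝ) {y : ℝ} (hy : 0 ≤ y) :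
    friableCount x ⌊y⌋₊ = friableCount x y := by
  have hfloor : friableUpTo x ⌊y⌋₊ = friableUpTo x y := by
    ext n
    simp only [mem_friableUpTo, IsFriable, Nat.cast_le, Nat.le_floor_iff hy]
  rw [friableCount, friableCount, hfloor]

theorem friableCount_mul_exp_half_le {x η : ℝ} {p : ℕ} (hp : p.Prime) (hη : 0 ≤ η) (hη1 : η ≤ 1)
    (h : η * friableCount x p ≤ friableCount (x / p) p) :
    friableCount x (p - 1 : ℕ) * exp (η / 2) ≤ friableCount x p := by
  have hexp : exp (η / 2) ≤ 1 + η := by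
    linarith [exp_sub_one_le_two_mul (s := η / 2) (by linarith) (by linarith)]
  have hmono : friableCount x (p - 1 : ℕ) ≤ friableCount x p :=
    friableCount_mono le_rfl (mod_cast Nat.sub_le p 1)
  calc friableCount x (p - 1 : ℕ) * exp (η / 2)
      ≤ friableCount x (p - 1 : ℕ) * (1 + η) :=
        mul_le_mul_of_nonneg_left hexp (friableCount_nonneg _ _)
    _ = friableCount x (p - 1 : ℕ) + η * friableCount x (p - 1 : ℕ) := by ring
    _ ≤ friableCount x (p - 1 : ℕ) + friableCount (x / p) p := by
        gcongr
        exact (mul_le_mul_of_nonneg_left hmono hη).trans h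
    _ = friableCount x p := (friableCount_prime x hp).symm

theorem friableCount_mul_exp_sum_le {x z Y : ℝ} (hz : 0 ≤ z) (hzY : z ≤ Y) {η : ℕ → ℝ}
    (hη : ∀ p ∈ primesIoc z Y, 0 ≤ η p ∧ η p ≤ 1 ∧
      η p * friableCount x p ≤ friableCount (x / p) p) :
    friableCount x z * exp (∑ p ∈ primesIoc z Y, η p / 2) ≤ friableCount x Y := by
  suffices h : ∀ N : ℕ, ⌊z⌋₊ ≤ N → N ≤ ⌊Y⌋₊ → friableCount x ⌊z⌋₊ *
      exp (∑ p ∈ Ioc ⌊z⌋₊ N with p.Prime, η p / 2) ≤ friableCount x N by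
    simpa only [primesIoc, friableCount_floor x hz, friableCount_floor x (hz.trans hzY)]
      using h ⌊Y⌋₊ (Nat.floor_le_floor hzY) le_rfl
  intro N hN
  induction N, hN using Nat.le_induction with
  | base => simp
  | succ N hN ih =>
    intro hNY
    have ih := ih (by lia)
    rw [← insert_Ioc_right_eq_Ioc_add_one hN, filter_insert]
    split_ifs with hp
    · obtain ⟨hη0, hη1, hdiv⟩ := hη (N + 1) (mem_filter.2 ⟨mem_Ioc.2 ⟨by lia, hNY⟩, hp⟩)
      rw [sum_insert (by simp), add_comm, exp_add, ← mul_assoc]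
      have hstep := friableCount_mul_exp_half_le hp hη0 hη1 hdiv
      rw [Nat.add_sub_cancel] at hstep
      exact (mul_le_mul_of_nonneg_right ih (exp_nonneg _)).trans hstep
    · exact ih.trans (friableCount_mono le_rfl (by push_cast; linarith))

theorem exists_friableCount_mul_exp_le : ∃ c C K : ℝ, 0 < c ∧ 4 ≤ C ∧ 1 < K ∧
    ∀ x z Y : ℝ, C ≤ z → C * log x ≤ z → K * z ≤ Y → Y ≤ x →
      friableCount x z * exp (c * (log x * log (Y / z) / log Y ^ 2)) ≤ friableCount x Y := by
  obtain ⟨c, C, hc, hc1, hC, hdiv⟩ := exists_mul_friableCount_le_friableCount_div_self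
  obtain ⟨K, hK, c', hc', hsum⟩ := exists_mul_log_div_log_le_sum_inv_primesIoc
  refine ⟨c * c' / 2, C, K, by positivity, hC, hK, fun x z Y hCz hxz hzY hYx ↦ ?_⟩
  have hzY' : z ≤ Y := by nlinarith
  have hlY : 1 / 2 ≤ log Y := half_le_log (by linarith)
  have hlx : log Y ≤ log x := log_le_log (by linarith) hYx
  have hη : ∀ p ∈ primesIoc z Y, 0 ≤ c * (log x / (p * log Y)) ∧ c * (log x / (p * log Y)) ≤ 1 ∧
      c * (log x / (p * log Y)) * friableCount x p ≤ friableCount (x / p) p := by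
    intro p hp
    rw [mem_primesIoc (by linarith) (by linarith)] at hp
    obtain ⟨-, hzp, hpY⟩ := hp
    have hp0 : (0 : ℝ) < p := by linarith
    have hlp : 0 < log p := log_pos (by linarith)
    have hΨ := friableCount_nonneg x p
    refine ⟨?_, ?_, ?_⟩
    · exact mul_nonneg hc.le (div_nonneg (by linarith) (mul_nonneg hp0.le (by linarith)))
    · refine mul_le_one₀ hc1 ?_ ?_
      · exact div_nonneg (by linarith) (mul_nonneg hp0.le (by linarith))
      · refine (div_le_one (mul_pos hp0 (by linarith))).2 ?_
        nlinarith
    · calc c * (log x / (p * log Y)) * friableCount x p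
          ≤ c * (log x / (p * log p)) * friableCount x p := by
            have : log p ≤ log Y := log_le_log hp0 hpY
            gcongr
            linarith
        _ ≤ friableCount (x / p) p := hdiv x p (by linarith) (by linarith) (hpY.trans hYx)
  refine le_trans ?_ (friableCount_mul_exp_sum_le (by linarith) hzY' hη)
  gcongr
  · exact friableCount_nonneg _ _
  calc c * c' / 2 * (log x * log (Y / z) / log Y ^ 2)
      = c * log x / (2 * log Y) * (c' * log (Y / z) / log Y) := by
        field_simp
    _ ≤ c * log x / (2 * log Y) * ∑ p ∈ primesIoc z Y, (1 : ℝ) / p := by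
        refine mul_le_mul_of_nonneg_left (hsum z Y (by linarith) hzY) ?_
        exact div_nonneg (mul_nonneg hc.le (by linarith)) (by linarith)
    _ = ∑ p ∈ primesIoc z Y, c * (log x / (p * log Y)) / 2 := by
        rw [mul_sum]
        exact sum_congr rfl fun p _ ↦ by field_simp

/-! ### Zeta sums bounded by friable counts -/

theorem norm_zetaSum_le_friableCount {x y : ℝ} (hxy : x ≤ y) (t : ℝ) :
    ‖zetaSum x t‖ ≤ friableCount x y := by
  rw [friableCount_eq_floor hxy]
  exact norm_zetaSum_le x t

theorem mul_le_mul_pow_of_le {C L a W : ℝ} {n : ℕ} (hn : n ≠ 0) (hL : 1 ≤ L) (hCL : C ≤ L)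
    (ha : 0 ≤ a) (haW : a ≤ W) : C * a ≤ W * L ^ n :=
  calc C * a ≤ L * W := mul_le_mul hCL haW ha (by linarith)
    _ ≤ L ^ n * W := mul_le_mul_of_nonneg_right (le_self_pow₀ hL hn) (ha.trans haW)
    _ = W * L ^ n := mul_comm _ _

theorem log_add_sq_mul_log_pow_le {τ a : ℝ} (hτ : 0 < τ) (hL : 2 ≤ log τ) (ha : 0 ≤ a)
    (haτ : a ≤ τ) : log ((τ + a ^ 2) * log τ ^ 5) ≤ 8 * log τ := by
  have hLτ : log τ ≤ τ - 1 := log_le_sub_one_of_pos hτ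
  have hsum : τ + a ^ 2 ≤ τ ^ 3 := by
    have hsq : a ^ 2 ≤ τ ^ 2 := pow_le_pow_left₀ ha haτ 2
    have hcube : 0 ≤ τ * (τ ^ 2 - τ - 1) := mul_nonneg hτ.le (by nlinarith)
    linarith
  calc log ((τ + a ^ 2) * log τ ^ 5) ≤ log (τ ^ 3 * τ ^ 5) := by
        refine log_le_log (mul_pos (by positivity) (pow_pos (by linarith) 5)) ?_
        gcongr
        linarith
    _ = 8 * log τ := by
        rw [← pow_add, log_pow]
        norm_num

theorem le_div_log_sq {τ a : ℝ} (hτ : 0 < τ) (hL : 0 < log τ) (ha : 6 * a ≤ log τ) :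
    a ≤ τ / log τ ^ 2 := by
  have hcube := pow_div_factorial_le_exp (log τ) hL.le 3
  rw [exp_log hτ, show Nat.factorial 3 = 6 from rfl, Nat.cast_ofNat] at hcube
  rw [le_div_iff₀ (by positivity)]
  calc a * log τ ^ 2 ≤ log τ / 6 * log τ ^ 2 := by gcongr; linarith
    _ = log τ ^ 3 / 6 := by ring
    _ ≤ τ := hcube

theorem add_mul_one_div_log_sq_le {τ a b : ℝ} (hτ : 0 < τ) (hL : 0 < log τ) (ha : 6 * a ≤ log τ)
    (hb : τ ≤ 2 * b) : a + τ * (1 / log τ ^ 2) ≤ 4 * (b / log τ ^ 2) :=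
  calc a + τ * (1 / log τ ^ 2) ≤ τ / log τ ^ 2 + τ / log τ ^ 2 := by
        rw [mul_one_div]
        gcongr
        exact le_div_log_sq hτ hL ha
    _ = 2 * τ / log τ ^ 2 := by ring
    _ ≤ 2 * (2 * b) / log τ ^ 2 := by gcongr
    _ = 4 * (b / log τ ^ 2) := by ring

theorem exp_mul_sq_div_sq_le {S δ b u v : ℝ} (hu : 0 ≤ u) (hv : 0 < v) (huv : u * exp δ ≤ v)
    (h : S + b ≤ 2 * δ) : exp S * u ^ 2 / v ^ 2 ≤ exp (-b) := by
  rw [div_le_iff₀ (by positivity)]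
  calc exp S * u ^ 2 ≤ exp (-b + 2 * δ) * u ^ 2 := by gcongr; linarith
    _ = exp (-b) * (u * exp δ) ^ 2 := by
        rw [exp_add, mul_pow, ← exp_nat_mul, Nat.cast_ofNat]
        ring
    _ ≤ exp (-b) * v ^ 2 := by gcongr

theorem mul_mul_sq_mul_log_div_le {C τ L a k z : ℝ} (hC : 0 ≤ C) (hτ : 0 < τ) (hL : 0 < L)
    (ha : 0 ≤ a) (hk : k * a ≤ τ) (hz : 1 ≤ z) (hzτ : τ * L ^ 3 ≤ z) (hlz : log z ≤ 8 * L) :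
    C * k * a ^ 2 * log z / z ≤ 8 * C * (a / L ^ 2) := by
  have hlz0 : 0 ≤ log z := log_nonneg hz
  calc C * k * a ^ 2 * log z / z = C * a * (k * a) * log z / z := by ring
    _ ≤ C * a * τ * (8 * L) / (τ * L ^ 3) := by gcongr
    _ = 8 * C * (a / L ^ 2) := by field_simp

theorem mul_div_sq_le_two_mul {c D a L ℓ : ℝ} (hc : 0 < c) (hD : 0 ≤ D) (ha : 0 ≤ a) (hL : 0 < L)
    (hℓ : 0 < ℓ) (hℓL : ℓ ≤ 8 * L) (hDL : 16 * D / c ≤ log L) :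
    D * (a / L ^ 2) ≤ 2 * (c * (a * log (L ^ 2) / ℓ ^ 2)) := by
  have hlL : 0 ≤ log L := le_trans (by positivity) hDL
  rw [log_pow, Nat.cast_ofNat]
  calc D * (a / L ^ 2) = c / 16 * (16 * D / c) * (a / L ^ 2) := by field_simp
    _ ≤ c / 16 * log L * (a / L ^ 2) := by gcongr
    _ = 2 * (c * (a * (2 * log L) / (8 * L) ^ 2)) := by ring
    _ ≤ 2 * (c * (a * (2 * log L) / ℓ ^ 2)) := by gcongr

theorem exists_exp_mul_friableCount_sq_div_sq_le {C : ℝ} (hC : 1 ≤ C) :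
    ∃ L₀ : ℝ, ∀ (τ x : ℝ) (k : ℕ), 0 < τ → L₀ ≤ log τ → 2 ≤ x → log x ≤ τ → k * log x ≤ τ →
      (τ + log x ^ 2) * log τ ^ 5 ≤ x →
      exp (C * k * log x ^ 2 * log ((τ + log x ^ 2) * log τ ^ 3) /
          ((τ + log x ^ 2) * log τ ^ 3)) * friableCount x ((τ + log x ^ 2) * log τ ^ 3) ^ 2 /
        friableCount x ((τ + log x ^ 2) * log τ ^ 5) ^ 2 ≤ exp (-(4 * (log x / log τ ^ 2))) := by
  obtain ⟨c, C', K, hc, hC', hK, hgrowth⟩ := exists_friableCount_mul_exp_le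
  set E := exp (16 * (8 * C + 4) / c)
  refine ⟨2 + C' + K + E, fun τ x k hτ hL hx hxτ hk hYx ↦ ?_⟩
  have hE : 0 < E := exp_pos _
  set L := log τ
  set W := τ + log x ^ 2
  have hL2 : 2 ≤ L := by linarith
  have hlx : 1 / 2 ≤ log x := half_le_log hx
  have hLτ : L ≤ τ - 1 := log_le_sub_one_of_pos hτ
  have hτW : τ ≤ W := le_add_of_nonneg_right (sq_nonneg _)
  have hYz : W * L ^ 5 = L ^ 2 * (W * L ^ 3) := by ring
  have hz : C' ≤ W * L ^ 3 := by
    simpa using mul_le_mul_pow_of_le three_ne_zero (by linarith) (by linarith) zero_le_one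
      (by linarith : (1 : ℝ) ≤ W)
  have hKL : K ≤ L ^ 2 := by nlinarith
  have hzY : W * L ^ 3 ≤ W * L ^ 5 := by
    rw [hYz]
    exact le_mul_of_one_le_left (by linarith) (by linarith)
  have hlY : log (W * L ^ 5) ≤ 8 * L :=
    log_add_sq_mul_log_pow_le hτ hL2 (by linarith) hxτ
  have hlY0 : 0 < log (W * L ^ 5) := log_pos (by linarith)
  have hlz : log (W * L ^ 3) ≤ 8 * L := (log_le_log (by linarith) hzY).trans hlY
  have hgrow := hgrowth x (W * L ^ 3) (W * L ^ 5) hz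
    (mul_le_mul_pow_of_le three_ne_zero (by linarith) (by linarith) (by linarith) (by linarith))
    (by rw [hYz]; gcongr) hYx
  rw [show W * L ^ 5 / (W * L ^ 3) = L ^ 2 by rw [hYz, mul_div_cancel_right₀ _ (by linarith)]]
    at hgrow
  refine exp_mul_sq_div_sq_le (friableCount_nonneg _ _) (friableCount_pos (by linarith) _) hgrow ?_
  have hS := mul_mul_sq_mul_log_div_le (C := C) (by linarith) hτ (by linarith) (by linarith) hk
    (by linarith) (show τ * L ^ 3 ≤ W * L ^ 3 by gcongr) hlz
  have hδ := mul_div_sq_le_two_mul (D := 8 * C + 4) hc (by linarith) (show 0 ≤ log x by linarith)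
    (show 0 < L by linarith) hlY0 hlY ((le_log_iff_exp_le (by linarith)).2 (by linarith))
  linarith

theorem exists_zetaSum_le_friableCount :
    ∃ T₀ : ℝ, ∀ T x : ℝ, T₀ ≤ T → 2 ≤ x → x ≤ T ^ (1 / 3 : ℝ) →
      volume {t : ℝ | t ∈ Set.Icc 1 T ∧
          ¬ ‖zetaSum x t‖ ≤ friableCount x ((log T + log x ^ 2) * log (log T) ^ 5)} ≤
        ENNReal.ofReal (T ^ (1 - 1 / log (log T) ^ 2)) := by
  obtain ⟨K, C, hK, hC, hvol⟩ := exists_volume_zetaSum_le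
  obtain ⟨L₀, hratio⟩ := exists_exp_mul_friableCount_sq_div_sq_le hC
  set L₁ := max L₀ (2 + C + 6 * log K)
  refine ⟨exp (exp L₁), fun T x hT hx hxT ↦ ?_⟩
  have hT0 : 0 < T := (exp_pos _).trans_le hT
  have hτ : exp L₁ ≤ log T := (le_log_iff_exp_le hT0).2 hT
  have hτ0 : 0 < log T := (exp_pos _).trans_le hτ
  have hL : L₁ ≤ log (log T) := (le_log_iff_exp_le hτ0).2 hτ
  have hL' : 2 + C + 6 * log K ≤ log (log T) := (le_max_right _ _).trans hL
  have hlK : 0 ≤ log K := log_nonneg hK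
  have hlx : 1 / 2 ≤ log x := half_le_log hx
  have hlxT : 3 * log x ≤ log T := three_mul_log_le_log (by linarith) hT0 hxT
  obtain ⟨k, hk, hxk, hkτ, hτk⟩ := exists_pow_le_and_log_le_two_mul (by linarith)
    ((log_le_log_iff (by linarith) hT0).1 (by linarith : log x ≤ log T))
  set L := log (log T)
  set W := log T + log x ^ 2
  rcases le_or_gt x (W * L ^ 5) with hxY | hYx
  · simp [norm_zetaSum_le_friableCount hxY]
  have hτW : log T ≤ W := le_add_of_nonneg_right (sq_nonneg _)
  have hLτ : L ≤ log T - 1 := log_le_sub_one_of_pos hτ0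
  have hCz : C * log x ^ 2 ≤ W * L ^ 3 := mul_le_mul_pow_of_le three_ne_zero (by linarith)
    (by linarith) (sq_nonneg _) (le_add_of_nonneg_left hτ0.le)
  have hCkz : C * k * log x ^ 2 ≤ (W * L ^ 3) ^ 2 :=
    calc C * k * log x ^ 2 = C * (k * log x * log x) := by ring
      _ ≤ W ^ 2 * L ^ 6 := by
          refine mul_le_mul_pow_of_le (by norm_num) (by linarith) (by linarith)
            (by positivity) ?_
          rw [sq]
          gcongr <;> linarith
      _ = (W * L ^ 3) ^ 2 := by ring
  have hz : 1 * 2 ≤ W * L ^ 3 := mul_le_mul_pow_of_le three_ne_zero (by linarith) (by linarith)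
    zero_le_two (by linarith)
  have hΨ := friableCount_pos (show 1 ≤ x by linarith) (W * L ^ 5)
  simp only [not_le]
  refine (hvol T x (W * L ^ 3) _ k hT0 (by linarith) (by linarith) hCz hCkz hxk hΨ).trans
    (ENNReal.ofReal_le_ofReal (mul_mul_pow_le_rpow_one_sub (by linarith) hT0 (by positivity)
      (hratio (log T) x k hτ0 ((le_max_left _ _).trans hL) hx (by linarith) hkτ hYx.le) ?_))
  exact (add_mul_one_div_log_sq_le hτ0 (by linarith) (by linarith) hτk).trans_eq (by ring)

theorem theorem1p1 :
    (∃ C : ℝ, 0 < C ∧ ∀ T x y : ℝ, 1 ≤ T → 2 ≤ x → x ≤ T ^ (1 / 3 : ℝ) →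
      Real.log x * Real.log T * Real.log (Real.log T) ^ 5 ≤ y →
      MeasureTheory.volume {t : ℝ | t ∈ Set.Icc 1 T ∧
          ¬ ‖zetaSum x t - friableSum x y t‖
            ≤ C * (friableCount x y / Real.log (Real.log T) ^ 2)}
        ≤ ENNReal.ofReal (T ^ (1 - 1 / Real.log x))) ∧
    (∃ T₀ : ℝ, ∀ T x : ℝ, T₀ ≤ T → 2 ≤ x → x ≤ T ^ (1 / 3 : ℝ) →
      MeasureTheory.volume {t : ℝ | t ∈ Set.Icc 1 T ∧
          ¬ ‖zetaSum x t‖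
            ≤ friableCount x
                ((Real.log T + Real.log x ^ 2) * Real.log (Real.log T) ^ 5)}
        ≤ ENNReal.ofReal (T ^ (1 - 1 / Real.log (Real.log T) ^ 2))) :=
  ⟨exists_zetaSum_sub_friableSum, exists_zetaSum_le_friableCount⟩
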